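/- **Theorem (Regret bound for OPLB).** Let $d\ge 3$, $T\in\mathbb N$, $R\ge 0$, $S,L>0$, $\lambda\ge L^2$, $\delta\in(0,1)$, and let $\theta_*,\mu_*\in\mathbb R^d$ with $\|\theta_*\|,\|\mu_*\|\le S$. *Setting.* In each round $t\in[T]$ a (possibly random) action set $\mathcal A_t\subset\mathbb R^d$ is given, such that every $x\in\mathcal A_t$ satisfies $\|x\|\le L$, $\langle x,\theta_*\rangle\in[0,1]$ and $\langle x,\mu_*\rangle\in[0,1]$. A known safe action $x_0$ belongs to all $\mathcal A_t$; its reward $r_0=\langle x_0,\theta_*\rangle$ and cost $c_0=\langle x_0,\mu_*\rangle$ are known, and $c_0<\tau$ for the known threshold $\tau$. The learner picks, as a (measurable) function of the past $\mathcal H_{t-1}$, a policy $\pi_t\in\Delta_{\mathcal A_t}$ (a probability distribution on $\mathcal A_t$), draws $X_t\sim\pi_t$ given $\mathcal H_{t-1}$, and observes $R_t=\langle X_t,\theta_*\rangle+\xi^r_t$ and $C_t=\langle X_t,\mu_*\rangle+\xi^c_t$, where conditionally on $\mathcal H_{t-1}$ and $X_t$ each of $\xi^r_t,\xi^c_t$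 has mean zero and is $R$-sub-Gaussian (conditional moment generating function at $a$ at most $e^{a^2R^2/2}$ for all $a\in\mathbb R$); $(\mathcal H_t)$ is a filtration and $X_t,\xi^r_t,\xi^c_t$ are $\mathcal H_t$-measurable. A policy $\pi\in\Delta_{\mathcal A_t}$ is feasible in round $t$ if $\mathbb E_{X\sim\pi}\langle X,\mu_*\rangle\le\tau$; let $\pi_t^*$ be a feasible policy in round $t$ with maximal $\mathbb E_{X\sim\pi}\langle X,\theta_*\rangle$. The regret is $$\mathcal R_\Pi(T)=\sum_{t=1}^T\Big(\mathbb E_{X\sim\pi^*_t}\langle X,\theta_*\rangle-\mathbb E_{X\sim\pi_t}\langle X,\theta_*\rangle\Big).$$ *Algorithm OPLB.* Let $e_0=x_0/\|x_0\|$ (and $e_0=0$ if $x_0=0$), $\mathcal V_o=\mathrm{span}(x_0)$, $x^o=\langle x,e_0\rangle e_0$, $x^{o,\perp}=x-x^o$, $k=\dim\mathcal V_o^\perp$ (so $k=d-1$ if $x_0\neq0$), and $$\beta_t(\delta,m)=R\sqrt{m\log\frac{1+(t-1)L^2/\lambda}{\delta}}+\sqrt\lambda\,S .$$ Put $\Sigma_t=\lambda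 I+\sum_{s<t}X_sX_s^\top$, $\Sigma^{o,\perp}_t=\lambda(I-e_0e_0^\top)+\sum_{s<t}X^{o,\perp}_s(X^{o,\perp}_s)^\top$, $C_s^\perp=C_s-\langle X_s,e_0\rangle c_0/\|x_0\|$ (with $C_s^\perp=C_s$ if $x_0=0$), $\widehat\theta_t=\Sigma_t^{-1}\sum_{s<t}R_sX_s$ and $\widehat\mu_t=(\Sigma_t^{o,\perp})^\dagger\sum_{s<t}C^\perp_sX^{o,\perp}_s$, where $\dagger$ is the Moore–Penrose pseudo-inverse. With $\|v\|_A=\sqrt{v^\top Av}$, let $$\mathcal C^r_t=\{\theta\in\mathbb R^d:\|\theta-\widehat\theta_t\|_{\Sigma_t}\le\alpha_r\beta_t(\delta,d)\},\qquad \mathcal C^c_t=\{\mu\in\mathcal V_o^\perp:\|\mu-\widehat\mu_t\|_{\Sigma_t^{o,\perp}}\le\alpha_c\beta_t(\delta,k)\}.$$ Let $\widetilde\Pi_t^f$ be the set of $\pi\in\Delta_{\mathcal A_t}$ with $\frac{\langle x_\pi^o,e_0\rangle c_0}{\|x_0\|}+\max_{\mu\in\mathcal C^c_t}\mathbb E_{X\sim\pi}\langle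 X,\mu\rangle\le\tau$, where $x_\pi^o=\mathbb E_{X\sim\pi}[X^o]$ and the first term is $0$ if $x_0=0$. In round $t$ OPLB plays a policy $\pi_t$ such that some $(\pi_t,\widetilde\theta_t)$ maximizes $\mathbb E_{X\sim\pi}\langle X,\theta\rangle$ over $\pi\in\widetilde\Pi^f_t$, $\theta\in\mathcal C^r_t$. *Conclusion.* Set $\alpha_c=1$ and $\alpha_r=1+\frac{2(1-r_0)}{\tau-c_0}$. Then with probability at least $1-2\delta$, the policy $\pi_t$ of OPLB is feasible in every round $t\in[T]$, and $$\mathcal R_\Pi(T)\le\frac{2L(\alpha_r+1)\beta_T(\delta,d)}{\sqrt\lambda}\sqrt{2T\log(1/\delta)}+(\alpha_r+1)\beta_T(\delta,d)\sqrt{2Td\log\Big(1+\frac{TL^2}{\lambda}\Big)} .$$ -/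

import Mathlib

open MeasureTheory ProbabilityTheory
open scoped Matrix

noncomputable section

namespace OPLB

/-- `ℝ^d` with the Euclidean norm. -/
abbrev Vec (d : ℕ) : Type := EuclideanSpace ℝ (Fin d)

/-! ### Linear algebra -/

/-- The four Penrose equations for a real square matrix `A`. -/
structure IsMoorePenrose {d : ℕ} (A B : Matrix (Fin d) (Fin d) ℝ) : Prop where
  mul_mul_self : A * B * A = A
  self_mul_mul : B * A * B = B
  left_symm : (A * B)ᵀ = A * B
  right_symm : (B * A)ᵀ = B * A

theorem IsMoorePenrose.unique {d : ℕ} {A B C : Matrix (Fin d) (Fin d) ℝ}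
    (hB : IsMoorePenrose A B) (hC : IsMoorePenrose A C) : B = C := by
  have h1 : A * B = A * C := by
    calc A * B = (A * B)ᵀ := hB.left_symm.symm
      _ = (A * C * (A * B))ᵀ := by rw [← Matrix.mul_assoc, hC.mul_mul_self]
      _ = A * B * (A * C) := by rw [Matrix.transpose_mul, hB.left_symm, hC.left_symm]
      _ = A * C := by rw [← Matrix.mul_assoc, hB.mul_mul_self]
  have h2 : B * A = C * A := by
    calc B * A = (B * A)ᵀ := hB.right_symm.symm
      _ = (B * A * (C * A))ᵀ := by
        rw [Matrix.mul_assoc, ← Matrix.mul_assoc A, hC.mul_mul_self]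
      _ = C * A * (B * A) := by rw [Matrix.transpose_mul, hB.right_symm, hC.right_symm]
      _ = C * A := by rw [Matrix.mul_assoc, ← Matrix.mul_assoc A, hB.mul_mul_self]
  calc B = B * A * B := hB.self_mul_mul.symm
    _ = C * A * C := by rw [h2, Matrix.mul_assoc, h1, ← Matrix.mul_assoc]
    _ = C := hC.self_mul_mul

theorem exists_isMoorePenrose_of_symm {d : ℕ} (A : Matrix (Fin d) (Fin d) ℝ)
    (hA : A.IsHermitian) : ∃ B, IsMoorePenrose A B ∧ Bᵀ = B := by
  obtain ⟨U, D, hU, hU', hD⟩ : ∃ (U : Matrix (Fin d) (Fin d) ℝ) (D : Fin d → ℝ),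
      U * Uᵀ = 1 ∧ Uᵀ * U = 1 ∧ A = U * Matrix.diagonal D * Uᵀ := by
    refine ⟨hA.eigenvectorUnitary, hA.eigenvalues, ?_, ?_, ?_⟩
    · have := (Matrix.mem_unitaryGroup_iff).1 hA.eigenvectorUnitary.2
      simpa [Matrix.star_eq_conjTranspose] using this
    · have := (Matrix.mem_unitaryGroup_iff').1 hA.eigenvectorUnitary.2
      simpa [Matrix.star_eq_conjTranspose] using this
    · have := hA.spectral_theorem
      simpa [Unitary.conjStarAlgAut_apply, Matrix.star_eq_conjTranspose, Function.comp_def]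
        using this
  have key : ∀ E F : Matrix (Fin d) (Fin d) ℝ,
      U * E * Uᵀ * (U * F * Uᵀ) = U * (E * F) * Uᵀ := by
    intro E F
    calc U * E * Uᵀ * (U * F * Uᵀ) = U * E * (Uᵀ * U) * F * Uᵀ := by
          simp only [Matrix.mul_assoc]
      _ = U * (E * F) * Uᵀ := by rw [hU', Matrix.mul_one, Matrix.mul_assoc U E F]
  have symm : ∀ F : Fin d → ℝ,
      (U * Matrix.diagonal F * Uᵀ)ᵀ = U * Matrix.diagonal F * Uᵀ := by
    intro F
    simp [Matrix.transpose_mul, Matrix.mul_assoc]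
  refine ⟨U * Matrix.diagonal (fun i => (D i)⁻¹) * Uᵀ, ⟨?_, ?_, ?_, ?_⟩, symm _⟩
  · rw [hD, key, key, Matrix.diagonal_mul_diagonal, Matrix.diagonal_mul_diagonal]
    simp
  · rw [hD, key, key, Matrix.diagonal_mul_diagonal, Matrix.diagonal_mul_diagonal]
    congr 3
    funext i
    by_cases h : D i = 0 <;> simp [h]
  · rw [hD, key, Matrix.diagonal_mul_diagonal, symm]
  · rw [hD, key, Matrix.diagonal_mul_diagonal, symm]

theorem exists_isMoorePenrose {d : ℕ} (A : Matrix (Fin d) (Fin d) ℝ) :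
    ∃ B, IsMoorePenrose A B := by
  have hM : (Aᵀ * A).IsHermitian := by
    simpa using Matrix.isHermitian_conjTranspose_mul_self A
  obtain ⟨G, hG, hGs⟩ := exists_isMoorePenrose_of_symm _ hM
  have hMs : (Aᵀ * A)ᵀ = Aᵀ * A := by simp [Matrix.transpose_mul]
  refine ⟨G * Aᵀ, ?_, ?_, ?_, ?_⟩
  · have h0 : A * (G * (Aᵀ * A) - 1) = 0 := by
      rw [← Matrix.conjTranspose_mul_self_eq_zero]
      rw [Matrix.conjTranspose_eq_transpose_of_trivial, Matrix.transpose_mul]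
      have : Aᵀ * (A * (G * (Aᵀ * A) - 1)) = 0 := by
        rw [← Matrix.mul_assoc, Matrix.mul_sub, Matrix.mul_one, ← Matrix.mul_assoc,
          hG.mul_mul_self, sub_self]
      rw [Matrix.mul_assoc, this, Matrix.mul_zero]
    rw [Matrix.mul_sub, Matrix.mul_one, sub_eq_zero] at h0
    simpa only [Matrix.mul_assoc] using h0
  · have := hG.self_mul_mul
    calc G * Aᵀ * A * (G * Aᵀ) = G * (Aᵀ * A) * G * Aᵀ := by simp only [Matrix.mul_assoc]
      _ = G * Aᵀ := by rw [this]
  · simp [Matrix.transpose_mul, hGs, Matrix.mul_assoc]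
  · have := hG.right_symm
    simpa only [Matrix.mul_assoc] using this

/-- The Moore-Penrose pseudo-inverse `A†`. -/
def pinv {d : ℕ} (A : Matrix (Fin d) (Fin d) ℝ) : Matrix (Fin d) (Fin d) ℝ :=
  Classical.choose (exists_isMoorePenrose A)

/-- The weighted (semi-)norm `‖v‖_A = √(vᵀ A v)`. -/
def wnorm {d : ℕ} (A : Matrix (Fin d) (Fin d) ℝ) (v : Vec d) : ℝ :=
  Real.sqrt (v.ofLp ⬝ᵥ (A *ᵥ v.ofLp))

/-- The rank-one matrix `v vᵀ`. -/
def outer {d : ℕ} (v : Vec d) : Matrix (Fin d) (Fin d) ℝ :=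
  Matrix.vecMulVec v.ofLp v.ofLp

/-- The matrix-vector product as a vector of Euclidean space. -/
def mulv {d : ℕ} (A : Matrix (Fin d) (Fin d) ℝ) (v : Vec d) : Vec d :=
  WithLp.toLp 2 (A *ᵥ v.ofLp)

/-- The normalized safe action `e₀ = x₀ / ‖x₀‖` (equal to `0` if `x₀ = 0`). -/
def unitDir {d : ℕ} (x₀ : Vec d) : Vec d := ‖x₀‖⁻¹ • x₀

/-- `𝒱_o^⊥`, the orthogonal complement of `𝒱_o = span(x₀)`; it is everything if `x₀ = 0`. -/
def perpSpace {d : ℕ} (x₀ : Vec d) : Submodule ℝ (Vec d) :=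
  (Submodule.span ℝ {x₀})ᗮ

/-- `x^o = ⟨x, e₀⟩ e₀`. -/
def projO {d : ℕ} (x₀ x : Vec d) : Vec d := inner ℝ x (unitDir x₀) • unitDir x₀

/-- `x^{o,⊥} = x - x^o`. -/
def projPerp {d : ℕ} (x₀ x : Vec d) : Vec d := x - projO x₀ x

/-! ### Policies -/

/-- `Δ_A`: the probability distributions on `ℝ^d` supported in `A`. -/
def policies {d : ℕ} (A : Set (Vec d)) : Set (Measure (Vec d)) :=
  {ρ | IsProbabilityMeasure ρ ∧ ρ Aᶜ = 0}

/-- `𝔼_{X ∼ ρ} ⟨X, v⟩`: the expected reward (`v = θ_*`) or cost (`v = μ_*`) of a policy. -/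
def expValue {d : ℕ} (v : Vec d) (ρ : Measure (Vec d)) : ℝ := ∫ x, inner ℝ x v ∂ρ

/-- `Π^f = {ρ ∈ Δ_A : 𝔼_{X ∼ ρ} ⟨X, μ_*⟩ ≤ τ}`. -/
def feasiblePolicies {d : ℕ} (μs : Vec d) (τ : ℝ) (A : Set (Vec d)) : Set (Measure (Vec d)) :=
  {ρ ∈ policies A | expValue μs ρ ≤ τ}

/-- `ρ ∈ argmax_{ρ' ∈ Π^f} 𝔼_{X ∼ ρ'} ⟨X, θ_*⟩`. -/
def IsOptimalFeasible {d : ℕ} (θs μs : Vec d) (τ : ℝ) (A : Set (Vec d))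
    (ρ : Measure (Vec d)) : Prop :=
  ρ ∈ feasiblePolicies μs τ A ∧ ∀ ρ' ∈ feasiblePolicies μs τ A, expValue θs ρ' ≤ expValue θs ρ

/-! ### The algorithm

Rounds are numbered from `0` in the code: index `t` is round `t + 1`, before which the `t`
observations with indices `s < t` have been made. -/

/-- What the algorithm knows: the safe action, its reward and cost, the threshold, the noise level
`R`, the bounds `S` (parameters) and `L` (actions), the regularization `lam`, the confidence
parameter `δ`, and the scaling parameters `α_r`, `α_c`. -/
structure Input (d : ℕ) where
  x₀ : Vec d
  r₀ : ℝ
  c₀ : ℝ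
  τ : ℝ
  R : ℝ
  S : ℝ
  L : ℝ
  lam : ℝ
  δ : ℝ
  αr : ℝ
  αc : ℝ

namespace Input

variable {d : ℕ} (I : Input d)

/-- `β_t(δ, k) = R √(k log((1 + (t - 1) L² / λ) / δ)) + √λ S`, with rounds `t = 1, 2, …`. -/
def beta (t k : ℕ) : ℝ :=
  I.R * Real.sqrt (k * Real.log ((1 + ((t : ℝ) - 1) * I.L ^ 2 / I.lam) / I.δ))
    + Real.sqrt I.lam * I.S

/-- `Σ_{t+1} = λ I + ∑_{s < t} x_s x_sᵀ`. -/
def gram (x : ℕ → Vec d) (t : ℕ) : Matrix (Fin d) (Fin d) ℝ :=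
  I.lam • (1 : Matrix (Fin d) (Fin d) ℝ) + ∑ s ∈ Finset.range t, outer (x s)

/-- `Σ^{o,⊥}_{t+1} = λ (I - e₀ e₀ᵀ) + ∑_{s < t} x_s^{o,⊥} (x_s^{o,⊥})ᵀ`. -/
def gramPerp (x : ℕ → Vec d) (t : ℕ) : Matrix (Fin d) (Fin d) ℝ :=
  I.lam • ((1 : Matrix (Fin d) (Fin d) ℝ) - outer (unitDir I.x₀))
    + ∑ s ∈ Finset.range t, outer (projPerp I.x₀ (x s))

/-- The regularized least-squares estimate of `θ_*` from actions `x` and rewards `r`. -/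
def thetaHat (x : ℕ → Vec d) (r : ℕ → ℝ) (t : ℕ) : Vec d :=
  mulv (I.gram x t)⁻¹ (∑ s ∈ Finset.range t, r s • x s)

/-- `C^⊥ = C - ⟨X, e₀⟩ c₀ / ‖x₀‖`. -/
def costPerp (x : Vec d) (c : ℝ) : ℝ :=
  c - inner ℝ x (unitDir I.x₀) * I.c₀ / ‖I.x₀‖

/-- The regularized least-squares estimate of `μ_*^{o,⊥}` from actions `x` and costs `c`. -/
def muHat (x : ℕ → Vec d) (c : ℕ → ℝ) (t : ℕ) : Vec d :=
  mulv (pinv (I.gramPerp x t))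
    (∑ s ∈ Finset.range t, I.costPerp (x s) (c s) • projPerp I.x₀ (x s))

/-- `𝒞^r_{t+1}(α_r)`. -/
def rewardSet (x : ℕ → Vec d) (r : ℕ → ℝ) (t : ℕ) : Set (Vec d) :=
  {θ | wnorm (I.gram x t) (θ - I.thetaHat x r t) ≤ I.αr * I.beta (t + 1) d}

/-- `𝒞^c_{t+1}(α_c)`; the dimension in the radius is that of `𝒱_o^⊥`, that is `d - 1` if
`x₀ ≠ 0` and `d` if `x₀ = 0`. -/
def costSet (x : ℕ → Vec d) (c : ℕ → ℝ) (t : ℕ) : Set (Vec d) :=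
  {μ | μ ∈ perpSpace I.x₀ ∧
    wnorm (I.gramPerp x t) (μ - I.muHat x c t)
      ≤ I.αc * I.beta (t + 1) (Module.finrank ℝ (perpSpace I.x₀))}

/-- The pessimistic cost value
`⟨x_ρ^o, e₀⟩ c₀ / ‖x₀‖ + max_{μ ∈ 𝒞^c} 𝔼_{X ∼ ρ} ⟨X, μ⟩` of a policy. -/
def pessCost (x : ℕ → Vec d) (c : ℕ → ℝ) (t : ℕ) (ρ : Measure (Vec d)) : ℝ :=
  inner ℝ (∫ y, projO I.x₀ y ∂ρ) (unitDir I.x₀) * I.c₀ / ‖I.x₀‖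
    + sSup ((fun μ => expValue μ ρ) '' I.costSet x c t)

/-- The estimated feasible policy set over the action set `A`. -/
def safePolicies (x : ℕ → Vec d) (c : ℕ → ℝ) (t : ℕ) (A : Set (Vec d)) :
    Set (Measure (Vec d)) :=
  {ρ ∈ policies A | I.pessCost x c t ρ ≤ I.τ}

/-- `ρ` is a policy that the algorithm may play after observing the actions, rewards and costs with
indices `s < t` and the action set `A`: for some `θ̃`, the pair `(ρ, θ̃)` maximizes
`𝔼_{X ∼ ρ} ⟨X, θ⟩` over estimated feasible policies and `θ ∈ 𝒞^r`. -/
def IsChoice (x : ℕ → Vec d) (r c : ℕ → ℝ) (t : ℕ) (A : Set (Vec d))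
    (ρ : Measure (Vec d)) : Prop :=
  ρ ∈ I.safePolicies x c t A ∧ ∃ θt ∈ I.rewardSet x r t,
    ∀ ρ' ∈ I.safePolicies x c t A, ∀ θ ∈ I.rewardSet x r t, expValue θ ρ' ≤ expValue θt ρ

end Input

/-! ### The interaction -/

/-- `ξ` is conditionally centred and `R`-sub-Gaussian given the sub-σ-algebra `m`. -/
structure CondSubGaussian {Ω : Type*} [mΩ : MeasurableSpace Ω] (P : Measure Ω)
    (m : MeasurableSpace Ω) (ξ : Ω → ℝ) (R : ℝ) : Prop where
  integrable : Integrable ξ P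
  integrable_exp : ∀ a : ℝ, Integrable (fun ω => Real.exp (a * ξ ω)) P
  centred : P[ξ | m] =ᵐ[P] 0
  mgf_le : ∀ a : ℝ, P[fun ω => Real.exp (a * ξ ω) | m] ≤ᵐ[P]
    fun _ => Real.exp (a ^ 2 * R ^ 2 / 2)

/-- `T` rounds of interaction in which the policy `π t` is a function of the past `𝓗 t`, the action
`X t` is drawn from `π t` given that past, and the noises are conditionally `R`-sub-Gaussian given
the past and the current action. -/
structure IsInteraction {Ω : Type*} [mΩ : MeasurableSpace Ω] (P : Measure Ω) {d : ℕ} (R : ℝ)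
    (T : ℕ) (𝓗 : Filtration ℕ mΩ) (π : ℕ → Ω → Measure (Vec d)) (X : ℕ → Ω → Vec d)
    (ξr ξc : ℕ → Ω → ℝ) : Prop where
  policy_measurable : ∀ t < T, ∀ B : Set (Vec d), MeasurableSet B →
    Measurable[𝓗 t] (fun ω => π t ω B)
  action_measurable : ∀ t < T, Measurable[𝓗 (t + 1)] (X t)
  noise_reward_measurable : ∀ t < T, Measurable[𝓗 (t + 1)] (ξr t)
  noise_cost_measurable : ∀ t < T, Measurable[𝓗 (t + 1)] (ξc t)
  action_law : ∀ t < T, ∀ B : Set (Vec d), MeasurableSet B →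
    P[(X t ⁻¹' B).indicator (fun _ => (1 : ℝ)) | 𝓗 t] =ᵐ[P] fun ω => (π t ω).real B
  noise_reward : ∀ t < T,
    CondSubGaussian P (𝓗 t ⊔ MeasurableSpace.comap (X t) inferInstance) (ξr t) R
  noise_cost : ∀ t < T,
    CondSubGaussian P (𝓗 t ⊔ MeasurableSpace.comap (X t) inferInstance) (ξc t) R

/-- The observed signals `⟨X_t, v⟩ + ξ_t`. -/
def signal {Ω : Type*} {d : ℕ} (v : Vec d) (X : ℕ → Ω → Vec d) (ξ : ℕ → Ω → ℝ)
    (ω : Ω) (t : ℕ) : ℝ := inner ℝ (X t ω) v + ξ t ω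

/-- The constrained pseudo-regret `∑_t (R_{π*_t} - R_{π_t})` along `ω`. -/
def regret {Ω : Type*} {d : ℕ} (θs : Vec d) (T : ℕ) (πstar π : ℕ → Ω → Measure (Vec d))
    (ω : Ω) : ℝ :=
  ∑ t ∈ Finset.range T, (expValue θs (πstar t ω) - expValue θs (π t ω))

end OPLB

end

/-! The argument is optimism in the face of uncertainty, with the complication that feasibility is
tested pessimistically. On an event of probability at least 1 − 2δ, in every round θ_* is within
β_t(δ,d) of its estimate and the component of μ_* orthogonal to x₀ lies in the cost confidence set.
The pessimistic cost then dominates the true cost, so every played policy is feasible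
(`Input.expValue_le_pessCost`).

An optimal policy may fail the pessimistic test. `Input.exists_le_expValue` mixes it with x₀ just
enough to pass; the reward lost is at most α_r − 1 times a confidence width of the mixture's mean,
and inflating the reward set by α_r makes room for a parameter that returns this loss. The
maximizing pair is therefore worth at least the optimal reward, and the regret of a round is at most
(α_r + 1)β_t times the expected width of X in the norm of Σ_t⁻¹ (`Input.expValue_sub_le`).
Azuma-Hoeffding replaces expected by realized widths (`measure_widthDeviation_le`), and the
elliptical potential bounds their sum (`Input.sum_wnorm_le`).

The confidence sets come from `Input.measure_exists_lt_wnorm_le`. The self-normalized exponential of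
the noise is a supermartingale: its one-step ratio is an average of exp(aξ − a²/2) over a
one-dimensional Gaussian a whose mean and variance are known before the noise
(`lintegral_mul_mixtureRatio_le`). Ville's inequality gives uniformity in time. For costs everything
is projected orthogonally to x₀, where the pseudo-inverse becomes a genuine inverse
(`Input.pinv_gramPerp`). -/

namespace OPLB

/-! ### Weighted norms and rank-one updates. -/

section LinearAlgebra

variable {d : ℕ}

theorem inner_eq_dotProduct (u v : Vec d) : inner ℝ u v = u.ofLp ⬝ᵥ v.ofLp := by
  rw [EuclideanSpace.inner_eq_star_dotProduct, dotProduct_comm]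
  simp

theorem inner_mulv (A : Matrix (Fin d) (Fin d) ℝ) (u v : Vec d) :
    inner ℝ u (mulv A v) = u.ofLp ⬝ᵥ (A *ᵥ v.ofLp) := inner_eq_dotProduct _ _

theorem wnorm_eq (A : Matrix (Fin d) (Fin d) ℝ) (v : Vec d) :
    wnorm A v = Real.sqrt (inner ℝ v (mulv A v)) := by rw [inner_mulv, wnorm]

theorem wnorm_nonneg (A : Matrix (Fin d) (Fin d) ℝ) (v : Vec d) : 0 ≤ wnorm A v :=
  Real.sqrt_nonneg _

theorem mulv_add (A : Matrix (Fin d) (Fin d) ℝ) (u v : Vec d) :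
    mulv A (u + v) = mulv A u + mulv A v := by
  ext i; simp [mulv, Matrix.mulVec_add]

theorem mulv_sub (A : Matrix (Fin d) (Fin d) ℝ) (u v : Vec d) :
    mulv A (u - v) = mulv A u - mulv A v := by
  ext i; simp [mulv, Matrix.mulVec_sub]

theorem mulv_smul (A : Matrix (Fin d) (Fin d) ℝ) (a : ℝ) (v : Vec d) :
    mulv A (a • v) = a • mulv A v := by
  ext i; simp [mulv, Matrix.mulVec_smul]

theorem add_mulv (A B : Matrix (Fin d) (Fin d) ℝ) (v : Vec d) :
    mulv (A + B) v = mulv A v + mulv B v := by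
  ext i; simp [mulv, Matrix.add_mulVec]

theorem sub_mulv (A B : Matrix (Fin d) (Fin d) ℝ) (v : Vec d) :
    mulv (A - B) v = mulv A v - mulv B v := by
  ext i; simp [mulv, Matrix.sub_mulVec]

theorem smul_mulv (a : ℝ) (A : Matrix (Fin d) (Fin d) ℝ) (v : Vec d) :
    mulv (a • A) v = a • mulv A v := by
  ext i; simp [mulv, Matrix.smul_mulVec]

theorem one_mulv (v : Vec d) : mulv (1 : Matrix (Fin d) (Fin d) ℝ) v = v := by
  ext i; simp [mulv]

theorem mulv_mulv (A B : Matrix (Fin d) (Fin d) ℝ) (v : Vec d) :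
    mulv A (mulv B v) = mulv (A * B) v := by
  ext i; simp [mulv, Matrix.mulVec_mulVec]

theorem sum_mulv {ι : Type*} (s : Finset ι) (A : ι → Matrix (Fin d) (Fin d) ℝ) (v : Vec d) :
    mulv (∑ i ∈ s, A i) v = ∑ i ∈ s, mulv (A i) v := by
  classical
  induction s using Finset.induction_on with
  | empty => ext i; simp [mulv]
  | insert a s ha ih => rw [Finset.sum_insert ha, Finset.sum_insert ha, add_mulv, ih]

theorem outer_mulv (x v : Vec d) : mulv (outer x) v = inner ℝ x v • x := by
  ext i
  simp [mulv, outer, Matrix.vecMulVec_mulVec, inner_eq_dotProduct]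

theorem inner_mulv_symm {A : Matrix (Fin d) (Fin d) ℝ} (hA : A.IsHermitian) (u v : Vec d) :
    inner ℝ (mulv A u) v = inner ℝ u (mulv A v) := by
  rw [real_inner_comm, inner_mulv, inner_mulv, Matrix.dotProduct_mulVec, dotProduct_comm,
    ← Matrix.mulVec_transpose]
  have : Aᵀ = A := by simpa using hA.eq
  rw [this]

theorem outer_isHermitian (x : Vec d) : (outer x).IsHermitian := by
  rw [Matrix.IsHermitian, outer, Matrix.conjTranspose_vecMulVec]
  simp

theorem posDef_iff_inner {A : Matrix (Fin d) (Fin d) ℝ} :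
    A.PosDef ↔ A.IsHermitian ∧ ∀ v : Vec d, v ≠ 0 → 0 < inner ℝ v (mulv A v) := by
  rw [Matrix.posDef_iff_dotProduct_mulVec]
  refine and_congr_right fun _ => ⟨fun h v hv => ?_, fun h v hv => ?_⟩
  · rw [inner_mulv]
    simpa using h (x := v.ofLp) (by simpa using hv)
  · simpa [inner_mulv] using h (WithLp.toLp 2 v) (by simpa using hv)

variable {A : Matrix (Fin d) (Fin d) ℝ}

theorem inner_mulv_self_nonneg (hA : A.PosDef) (v : Vec d) : 0 ≤ inner ℝ v (mulv A v) := by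
  by_cases hv : v = 0
  · simp [hv]
  · exact ((posDef_iff_inner.1 hA).2 v hv).le

theorem wnorm_sq (hA : A.PosDef) (v : Vec d) : wnorm A v ^ 2 = inner ℝ v (mulv A v) := by
  rw [wnorm_eq, Real.sq_sqrt (inner_mulv_self_nonneg hA v)]

theorem isUnit_det (hA : A.PosDef) : IsUnit A.det := by
  exact (Matrix.isUnit_iff_isUnit_det A).1 hA.isUnit

theorem mulv_inv_mulv (hA : A.PosDef) (v : Vec d) : mulv A (mulv A⁻¹ v) = v := by
  rw [mulv_mulv, Matrix.mul_nonsing_inv _ (isUnit_det hA), one_mulv]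

theorem inv_mulv_mulv (hA : A.PosDef) (v : Vec d) : mulv A⁻¹ (mulv A v) = v := by
  rw [mulv_mulv, Matrix.nonsing_inv_mul _ (isUnit_det hA), one_mulv]

theorem wnorm_mulv_inv (hA : A.PosDef) (v : Vec d) : wnorm A (mulv A⁻¹ v) = wnorm A⁻¹ v := by
  rw [wnorm_eq, wnorm_eq, mulv_inv_mulv hA, real_inner_comm]

/-- Cauchy-Schwarz for the inner product of a positive definite matrix. -/
theorem inner_mulv_le (hA : A.PosDef) (u v : Vec d) :
    inner ℝ u (mulv A v) ≤ wnorm A u * wnorm A v := by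
  obtain ⟨B, hB⟩ : ∃ B : Matrix (Fin d) (Fin d) ℝ, A = Bᴴ * B := by
    open scoped MatrixOrder in
    exact CStarAlgebra.nonneg_iff_eq_star_mul_self.mp hA.posSemidef.nonneg
  have key : ∀ u v : Vec d, inner ℝ u (mulv A v) = inner ℝ (mulv B u) (mulv B v) := by
    intro u v
    rw [inner_mulv, inner_eq_dotProduct, hB, ← Matrix.mulVec_mulVec, Matrix.dotProduct_mulVec,
      Matrix.vecMul_conjTranspose]
    simp [mulv]
  rw [wnorm_eq, wnorm_eq, key, key, key, real_inner_self_eq_norm_sq, real_inner_self_eq_norm_sq,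
    Real.sqrt_sq (norm_nonneg _), Real.sqrt_sq (norm_nonneg _)]
  exact real_inner_le_norm _ _

theorem inner_le_wnorm_mul_wnorm (hA : A.PosDef) (u v : Vec d) :
    inner ℝ u v ≤ wnorm A⁻¹ u * wnorm A v := by
  have h := inner_mulv_le hA (mulv A⁻¹ u) v
  rwa [wnorm_mulv_inv hA, inner_mulv_symm hA.inv.isHermitian, inv_mulv_mulv hA] at h

theorem wnorm_add_le (hA : A.PosDef) (u v : Vec d) :
    wnorm A (u + v) ≤ wnorm A u + wnorm A v := by
  refine Real.sqrt_le_iff.2 ⟨add_nonneg (wnorm_nonneg _ _) (wnorm_nonneg _ _), ?_⟩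
  rw [← inner_mulv, mulv_add, inner_add_left, inner_add_right, inner_add_right]
  have h1 := inner_mulv_le hA u v
  have h2 := inner_mulv_le hA v u
  have h3 := wnorm_sq hA u
  have h4 := wnorm_sq hA v
  nlinarith

theorem wnorm_smul (A : Matrix (Fin d) (Fin d) ℝ) (a : ℝ) (v : Vec d) :
    wnorm A (a • v) = |a| * wnorm A v := by
  rw [wnorm_eq, wnorm_eq, mulv_smul, inner_smul_left, inner_smul_right, conj_trivial,
    ← mul_assoc, Real.sqrt_mul (mul_self_nonneg a), ← sq, Real.sqrt_sq_eq_abs]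

theorem wnorm_neg (A : Matrix (Fin d) (Fin d) ℝ) (v : Vec d) : wnorm A (-v) = wnorm A v := by
  simp [wnorm, Matrix.mulVec_neg]

theorem wnorm_sub_comm (A : Matrix (Fin d) (Fin d) ℝ) (u v : Vec d) :
    wnorm A (u - v) = wnorm A (v - u) := by
  rw [← wnorm_neg, neg_sub]

theorem wnorm_sub_le (hA : A.PosDef) (u v w : Vec d) :
    wnorm A (u - w) ≤ wnorm A (u - v) + wnorm A (w - v) := by
  rw [wnorm_sub_comm A w v, ← sub_add_sub_cancel u v w]
  exact wnorm_add_le hA _ _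

theorem posDef_add_outer (hA : A.PosDef) (x : Vec d) : (A + outer x).PosDef := by
  refine hA.add_posSemidef ?_
  simpa [outer] using Matrix.posSemidef_vecMulVec_self_star x.ofLp

theorem det_add_outer (hA : A.PosDef) (x : Vec d) :
    (A + outer x).det = A.det * (1 + inner ℝ x (mulv A⁻¹ x)) := by
  rw [outer, Matrix.vecMulVec_eq Unit, Matrix.det_add_replicateCol_mul_replicateRow (isUnit_det hA),
    inner_mulv, Matrix.det_unique (n := Unit), Matrix.mul_assoc, ← Matrix.replicateCol_mulVec]
  simp [Matrix.mul_apply, dotProduct]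

/-- Sherman-Morrison, checked by applying the updated matrix to the candidate. -/
theorem inv_add_outer_mulv (hA : A.PosDef) (x z : Vec d) :
    mulv (A + outer x)⁻¹ z = mulv A⁻¹ z
      - (inner ℝ x (mulv A⁻¹ z) / (1 + inner ℝ x (mulv A⁻¹ x))) • mulv A⁻¹ x := by
  have hw := inner_mulv_self_nonneg hA.inv x
  set w := inner ℝ x (mulv A⁻¹ x) with hw'
  have hne : 1 + w ≠ 0 := by positivity
  set q := mulv A⁻¹ z - (inner ℝ x (mulv A⁻¹ z) / (1 + w)) • mulv A⁻¹ x with hq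
  have : mulv (A + outer x) q = z := by
    rw [hq, mulv_sub, mulv_smul, add_mulv, add_mulv, mulv_inv_mulv hA, mulv_inv_mulv hA,
      outer_mulv, outer_mulv, ← hw']
    have : inner ℝ x (mulv A⁻¹ z) • x
        = (inner ℝ x (mulv A⁻¹ z) / (1 + w)) • (x + w • x) := by
      rw [smul_add, smul_smul, ← add_smul]
      congr 1
      field_simp
    rw [this]
    simp
  rw [← this, inv_mulv_mulv (posDef_add_outer hA x)]

/-- With u = ⟨x, A⁻¹s⟩ and w = ⟨x, A⁻¹x⟩, the increment is twice the exponent in `mixtureRatio u w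
y`; this is what makes the self-normalized exponential factor round by round. -/
theorem inner_inv_add_outer (hA : A.PosDef) (x s : Vec d) (y : ℝ) :
    inner ℝ (s + y • x) (mulv (A + outer x)⁻¹ (s + y • x)) = inner ℝ s (mulv A⁻¹ s)
      + (2 * inner ℝ x (mulv A⁻¹ s) * y + inner ℝ x (mulv A⁻¹ x) * y ^ 2
        - inner ℝ x (mulv A⁻¹ s) ^ 2) / (1 + inner ℝ x (mulv A⁻¹ x)) := by
  have hw := inner_mulv_self_nonneg hA.inv x
  have hne : 1 + inner ℝ x (mulv A⁻¹ x) ≠ 0 := by positivity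
  have hs : inner ℝ s (mulv A⁻¹ x) = inner ℝ x (mulv A⁻¹ s) := by
    rw [← inner_mulv_symm hA.inv.isHermitian, real_inner_comm]
  rw [inv_add_outer_mulv hA, mulv_add, mulv_smul]
  simp only [inner_add_left, inner_add_right, inner_sub_right, inner_smul_left, inner_smul_right,
    hs, conj_trivial]
  field_simp
  ring

theorem inner_inv_le (hA : A.PosDef) {lam : ℝ} (hlam : 0 < lam)
    (h : ∀ v : Vec d, lam * ‖v‖ ^ 2 ≤ inner ℝ v (mulv A v)) (v : Vec d) :
    inner ℝ v (mulv A⁻¹ v) ≤ ‖v‖ ^ 2 / lam := by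
  have h1 := h (mulv A⁻¹ v)
  rw [mulv_inv_mulv hA, real_inner_comm] at h1
  have h2 := real_inner_le_norm v (mulv A⁻¹ v)
  set q := inner ℝ v (mulv A⁻¹ v)
  rw [le_div_iff₀ hlam]
  by_contra! hc
  have hn := norm_nonneg v
  have hm := norm_nonneg (mulv A⁻¹ v)
  nlinarith [sq_nonneg (‖v‖ - lam * ‖mulv A⁻¹ v‖)]

theorem det_le_pow (hA : A.PosDef) {M : ℝ}
    (h : ∀ v : Vec d, inner ℝ v (mulv A v) ≤ M * ‖v‖ ^ 2) : A.det ≤ M ^ d := by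
  have hH := hA.isHermitian
  rw [hH.det_eq_prod_eigenvalues]
  calc (∏ i, (hH.eigenvalues i : ℝ)) ≤ ∏ _i : Fin d, M := by
        refine Finset.prod_le_prod (fun i _ => (hA.eigenvalues_pos i).le) fun i _ => ?_
        have h1 := h (hH.eigenvectorBasis i)
        have h2 : mulv A (hH.eigenvectorBasis i) = hH.eigenvalues i • hH.eigenvectorBasis i := by
          have := hH.mulVec_eigenvectorBasis i
          ext j
          simpa [mulv] using congrFun this j
        rw [h2, inner_smul_right, real_inner_self_eq_norm_sq,
          hH.eigenvectorBasis.orthonormal.1 i] at h1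
        simpa using h1
    _ = M ^ d := by simp

end LinearAlgebra

/-! ### Gram matrices, least squares and the elliptical potential. -/

section Gram

variable {d : ℕ} (I : Input d)

theorem Input.gram_zero (x : ℕ → Vec d) :
    I.gram x 0 = I.lam • (1 : Matrix (Fin d) (Fin d) ℝ) := by simp [Input.gram]

theorem Input.gram_succ (x : ℕ → Vec d) (t : ℕ) :
    I.gram x (t + 1) = I.gram x t + outer (x t) := by
  rw [Input.gram, Input.gram, Finset.sum_range_succ, add_assoc]

theorem Input.gram_posDef (hlam : 0 < I.lam) (x : ℕ → Vec d) (t : ℕ) : (I.gram x t).PosDef := by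
  induction t with
  | zero => rw [I.gram_zero]; exact Matrix.PosDef.one.smul hlam
  | succ t ih => rw [I.gram_succ]; exact posDef_add_outer ih _

theorem Input.gram_mulv (x : ℕ → Vec d) (t : ℕ) (v : Vec d) :
    mulv (I.gram x t) v = I.lam • v + ∑ s ∈ Finset.range t, inner ℝ (x s) v • x s := by
  simp only [Input.gram, add_mulv, smul_mulv, one_mulv, sum_mulv, outer_mulv]

theorem Input.inner_gram_mulv (x : ℕ → Vec d) (t : ℕ) (v : Vec d) :
    inner ℝ v (mulv (I.gram x t) v)
      = I.lam * ‖v‖ ^ 2 + ∑ s ∈ Finset.range t, inner ℝ (x s) v ^ 2 := by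
  simp only [I.gram_mulv, inner_add_right, inner_smul_right, inner_sum, real_inner_self_eq_norm_sq]
  congr 1
  refine Finset.sum_congr rfl fun s _ => ?_
  rw [real_inner_comm v, sq]

theorem Input.le_inner_gram_mulv (x : ℕ → Vec d) (t : ℕ) (v : Vec d) :
    I.lam * ‖v‖ ^ 2 ≤ inner ℝ v (mulv (I.gram x t) v) := by
  rw [I.inner_gram_mulv]
  exact le_add_of_nonneg_right (Finset.sum_nonneg fun _ _ => sq_nonneg _)

theorem Input.inner_gram_mulv_le {x : ℕ → Vec d} {t : ℕ} {L : ℝ}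
    (hx : ∀ s < t, ‖x s‖ ≤ L) (v : Vec d) :
    inner ℝ v (mulv (I.gram x t) v) ≤ (I.lam + t * L ^ 2) * ‖v‖ ^ 2 := by
  rw [I.inner_gram_mulv, add_mul]
  gcongr
  calc ∑ s ∈ Finset.range t, inner ℝ (x s) v ^ 2
      ≤ ∑ _s ∈ Finset.range t, L ^ 2 * ‖v‖ ^ 2 := by
        refine Finset.sum_le_sum fun s hs => ?_
        have h1 := hx s (Finset.mem_range.1 hs)
        rw [← sq_abs, ← mul_pow]
        have := abs_real_inner_le_norm (x s) v
        gcongr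
        exact this.trans (by gcongr)
    _ = t * L ^ 2 * ‖v‖ ^ 2 := by simp [mul_assoc]

theorem Input.wnorm_inv_gram_le (hlam : 0 < I.lam) (x : ℕ → Vec d) (t : ℕ) (v : Vec d) :
    wnorm (I.gram x t)⁻¹ v ≤ ‖v‖ / Real.sqrt I.lam := by
  rw [wnorm_eq]
  refine (Real.sqrt_le_sqrt (inner_inv_le (I.gram_posDef hlam x t) hlam
    (I.le_inner_gram_mulv x t) v)).trans ?_
  rw [Real.sqrt_div (sq_nonneg _), Real.sqrt_sq (norm_nonneg _)]

/-- The error of regularized least squares for features `x` and targets `⟨x_s, v⟩ + ξ_s`. -/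
theorem Input.wnorm_sub_leastSquares_le (hlam : 0 < I.lam) (x : ℕ → Vec d) (ξ : ℕ → ℝ) (t : ℕ)
    (v : Vec d) :
    wnorm (I.gram x t) (v - mulv (I.gram x t)⁻¹
        (∑ s ∈ Finset.range t, (inner ℝ (x s) v + ξ s) • x s))
      ≤ wnorm (I.gram x t)⁻¹ (∑ s ∈ Finset.range t, ξ s • x s) + Real.sqrt I.lam * ‖v‖ := by
  have hV := I.gram_posDef hlam x t
  have h1 : v - mulv (I.gram x t)⁻¹ (∑ s ∈ Finset.range t, (inner ℝ (x s) v + ξ s) • x s)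
      = mulv (I.gram x t)⁻¹ (-(∑ s ∈ Finset.range t, ξ s • x s) + I.lam • v) := by
    have h := congrArg (mulv (I.gram x t)⁻¹) (I.gram_mulv x t v)
    rw [inv_mulv_mulv hV] at h
    nth_rw 1 [h]
    rw [← mulv_sub]
    congr 1
    simp only [add_smul, Finset.sum_add_distrib]
    abel
  rw [h1, wnorm_mulv_inv hV]
  refine (wnorm_add_le hV.inv _ _).trans ?_
  rw [wnorm_neg, wnorm_smul, abs_of_pos hlam]
  refine add_le_add le_rfl ?_
  calc I.lam * wnorm (I.gram x t)⁻¹ v ≤ I.lam * (‖v‖ / Real.sqrt I.lam) := by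
        gcongr; exact I.wnorm_inv_gram_le hlam x t v
    _ = Real.sqrt I.lam * ‖v‖ := by
        rw [mul_div_left_comm, Real.div_sqrt, mul_comm]

theorem Input.det_gram_zero (x : ℕ → Vec d) : (I.gram x 0).det = I.lam ^ d := by
  simp [I.gram_zero]

theorem Input.det_gram_le (hlam : 0 < I.lam) {x : ℕ → Vec d} {t : ℕ} {L : ℝ}
    (hx : ∀ s < t, ‖x s‖ ≤ L) :
    (I.gram x t).det / I.lam ^ d ≤ (1 + t * L ^ 2 / I.lam) ^ d := by
  rw [div_le_iff₀ (by positivity), ← mul_pow]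
  refine (det_le_pow (I.gram_posDef hlam x t) (I.inner_gram_mulv_le hx)).trans_eq ?_
  congr 1
  field_simp

/-- The elliptical potential lemma. -/
theorem Input.sum_wnorm_sq_le (hlam : 0 < I.lam) {x : ℕ → Vec d} {T : ℕ}
    (hx : ∀ s < T, ‖x s‖ ^ 2 ≤ I.lam) :
    ∑ t ∈ Finset.range T, wnorm (I.gram x t)⁻¹ (x t) ^ 2
      ≤ 2 * Real.log ((I.gram x T).det / I.lam ^ d) := by
  induction T with
  | zero => simp [I.det_gram_zero, hlam.ne']
  | succ T ih =>
    have hV := I.gram_posDef hlam x T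
    rw [Finset.sum_range_succ, I.gram_succ, det_add_outer hV, wnorm_sq hV.inv]
    have hw := inner_mulv_self_nonneg hV.inv (x T)
    -- Regularization at least as large as the squared actions keeps w ≤ 1, where w/2 ≤ log(1 + w);
    -- the logarithms telescope into the log-determinant.
    have hw1 : inner ℝ (x T) (mulv (I.gram x T)⁻¹ (x T)) ≤ 1 :=
      (inner_inv_le hV hlam (I.le_inner_gram_mulv x T) _).trans
        ((div_le_one hlam).2 (hx T (by simp)))
    set w := inner ℝ (x T) (mulv (I.gram x T)⁻¹ (x T))
    have h1 : w / 2 ≤ Real.log (1 + w) := by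
      refine le_trans ?_ (Real.le_log_one_add_of_nonneg hw)
      rw [div_le_div_iff₀ (by norm_num) (by positivity)]
      nlinarith
    have h2 := ih fun s hs => hx s (by omega)
    have hdet := hV.det_pos
    rw [mul_div_right_comm, Real.log_mul (by positivity) (by positivity)]
    linarith

theorem Input.sum_wnorm_le (hlam : 0 < I.lam) {x : ℕ → Vec d} {T : ℕ} {L : ℝ}
    (hL : L ^ 2 ≤ I.lam) (hx : ∀ s < T, ‖x s‖ ≤ L) :
    ∑ t ∈ Finset.range T, wnorm (I.gram x t)⁻¹ (x t)
      ≤ Real.sqrt (2 * T * d * Real.log (1 + T * L ^ 2 / I.lam)) := by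
  refine Real.le_sqrt_of_sq_le ?_
  have h1 := sq_sum_le_card_mul_sum_sq (s := Finset.range T)
    (f := fun t => wnorm (I.gram x t)⁻¹ (x t))
  rw [Finset.card_range] at h1
  have h2 := I.sum_wnorm_sq_le hlam (x := x) (T := T) fun s hs =>
    (pow_le_pow_left₀ (norm_nonneg _) (hx s hs) 2).trans hL
  have hdet := (I.gram_posDef hlam x T).det_pos
  have h3 := Real.log_le_log (by positivity) (I.det_gram_le hlam hx)
  rw [Real.log_pow] at h3
  calc _ ≤ (T : ℝ) * ∑ t ∈ Finset.range T, wnorm (I.gram x t)⁻¹ (x t) ^ 2 := h1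
    _ ≤ T * (2 * (d * Real.log (1 + T * L ^ 2 / I.lam))) := by
        gcongr; linarith
    _ = _ := by ring

end Gram

/-! ### Projection orthogonal to the safe action. -/

section Perp

variable {d : ℕ} (I : Input d)

theorem unitDir_zero : unitDir (0 : Vec d) = 0 := by simp [unitDir]

/-- True for a unit vector and for zero alike, so most later identities need no case split on x₀ =
0. -/
theorem inner_unitDir_self_smul (x₀ : Vec d) :
    inner ℝ (unitDir x₀) (unitDir x₀) • unitDir x₀ = unitDir x₀ := by
  by_cases h : x₀ = 0
  · simp [h, unitDir_zero]
  · rw [real_inner_self_eq_norm_sq, unitDir, norm_smul, norm_inv, norm_norm,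
      inv_mul_cancel₀ (norm_ne_zero_iff.2 h)]
    simp

theorem mem_perpSpace {x₀ v : Vec d} : v ∈ perpSpace x₀ ↔ inner ℝ (unitDir x₀) v = 0 := by
  rw [perpSpace, Submodule.mem_orthogonal_singleton_iff_inner_right, unitDir, inner_smul_left]
  by_cases h : x₀ = 0
  · simp [h]
  · simp [h]

theorem projPerp_eq (x₀ x : Vec d) :
    projPerp x₀ x = x - inner ℝ x (unitDir x₀) • unitDir x₀ := rfl

theorem inner_unitDir_projPerp (x₀ x : Vec d) : inner ℝ (unitDir x₀) (projPerp x₀ x) = 0 := by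
  rw [projPerp_eq, inner_sub_right, inner_smul_right, real_inner_comm, sub_eq_zero]
  have := congrArg (inner ℝ x) (inner_unitDir_self_smul x₀)
  rw [inner_smul_right] at this
  rw [mul_comm, this]

theorem projPerp_mem (x₀ x : Vec d) : projPerp x₀ x ∈ perpSpace x₀ :=
  mem_perpSpace.2 (inner_unitDir_projPerp x₀ x)

theorem inner_projPerp_left {x₀ v : Vec d} (hv : v ∈ perpSpace x₀) (x : Vec d) :
    inner ℝ (projPerp x₀ x) v = inner ℝ x v := by
  rw [projPerp_eq, inner_sub_left, inner_smul_left, mem_perpSpace.1 hv]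
  simp

theorem norm_projPerp_le (x₀ x : Vec d) : ‖projPerp x₀ x‖ ≤ ‖x‖ := by
  have h := inner_projPerp_left (projPerp_mem x₀ x) x
  rw [real_inner_self_eq_norm_sq] at h
  have h2 := real_inner_le_norm x (projPerp x₀ x)
  by_contra! hc
  have := norm_nonneg x
  nlinarith

theorem projPerp_add (x₀ x y : Vec d) : projPerp x₀ (x + y) = projPerp x₀ x + projPerp x₀ y := by
  simp only [projPerp_eq, inner_add_left, add_smul]; abel

theorem projPerp_smul (x₀ x : Vec d) (a : ℝ) : projPerp x₀ (a • x) = a • projPerp x₀ x := by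
  simp only [projPerp_eq, inner_smul_left, smul_sub, smul_smul, conj_trivial]

theorem self_eq_norm_smul_unitDir (x₀ : Vec d) : x₀ = ‖x₀‖ • unitDir x₀ := by
  by_cases h : x₀ = 0
  · simp [h]
  · rw [unitDir, smul_inv_smul₀ (norm_ne_zero_iff.2 h)]

theorem projPerp_self (x₀ : Vec d) : projPerp x₀ x₀ = 0 := by
  have h := self_eq_norm_smul_unitDir x₀
  have h1 : inner ℝ x₀ (unitDir x₀) = ‖x₀‖ * inner ℝ (unitDir x₀) (unitDir x₀) := by
    rw [← real_inner_smul_left, ← h]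
  rw [projPerp_eq, h1, mul_smul, inner_unitDir_self_smul, ← h, sub_self]

theorem inner_unitDir_eq (x₀ v : Vec d) : inner ℝ (unitDir x₀) v = inner ℝ x₀ v / ‖x₀‖ := by
  rw [unitDir, inner_smul_left, div_eq_inv_mul]; simp

theorem finrank_perpSpace_zero : Module.finrank ℝ (perpSpace (0 : Vec d)) = d := by
  rw [perpSpace, Submodule.span_zero_singleton, Submodule.bot_orthogonal_eq_top, finrank_top,
    finrank_euclideanSpace_fin]

theorem finrank_perpSpace {x₀ : Vec d} (h : x₀ ≠ 0) :
    Module.finrank ℝ (perpSpace x₀) + 1 = d := by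
  have h1 := Submodule.finrank_add_finrank_orthogonal (Submodule.span ℝ {x₀})
  rw [finrank_span_singleton h] at h1
  rw [perpSpace]
  simpa [add_comm] using h1

theorem norm_unitDir {x₀ : Vec d} (h : x₀ ≠ 0) : ‖unitDir x₀‖ = 1 := by
  rw [unitDir, norm_smul, norm_inv, norm_norm, inv_mul_cancel₀ (norm_ne_zero_iff.2 h)]

/-- The Gram matrix of the projected actions, regularized in all directions. -/
noncomputable def Input.gramProj (x : ℕ → Vec d) (t : ℕ) : Matrix (Fin d) (Fin d) ℝ :=
  I.gram (fun s => projPerp I.x₀ (x s)) t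

theorem Input.gramPerp_eq (x : ℕ → Vec d) (t : ℕ) :
    I.gramPerp x t = I.gramProj x t - I.lam • outer (unitDir I.x₀) := by
  rw [Input.gramPerp, Input.gramProj, Input.gram, smul_sub]; abel

theorem Input.gramProj_posDef (hlam : 0 < I.lam) (x : ℕ → Vec d) (t : ℕ) :
    (I.gramProj x t).PosDef := I.gram_posDef hlam _ t

theorem ext_mulv {A B : Matrix (Fin d) (Fin d) ℝ} (h : ∀ v : Vec d, mulv A v = mulv B v) :
    A = B := by
  refine Matrix.ext_of_mulVec_single fun i => ?_
  simpa [mulv] using h (WithLp.toLp 2 (Pi.single i 1))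

theorem Input.gramProj_mulv_unitDir (x : ℕ → Vec d) (t : ℕ) :
    mulv (I.gramProj x t) (unitDir I.x₀) = I.lam • unitDir I.x₀ := by
  rw [Input.gramProj, I.gram_mulv, Finset.sum_eq_zero, add_zero]
  intro s _
  rw [real_inner_comm, inner_unitDir_projPerp, zero_smul]

theorem Input.gramProj_mul_outer (x : ℕ → Vec d) (t : ℕ) :
    I.gramProj x t * outer (unitDir I.x₀) = I.lam • outer (unitDir I.x₀) := by
  refine ext_mulv fun v => ?_
  rw [← mulv_mulv, smul_mulv, outer_mulv, mulv_smul, I.gramProj_mulv_unitDir, smul_comm]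

theorem outer_unitDir_mul_self (x₀ : Vec d) :
    outer (unitDir x₀) * outer (unitDir x₀) = outer (unitDir x₀) := by
  refine ext_mulv fun v => ?_
  rw [← mulv_mulv, outer_mulv, outer_mulv, inner_smul_right, mul_smul, inner_unitDir_self_smul]

/-- Write V for `gramProj` and E = e₀e₀ᵀ. Since V e₀ = λ e₀, subtracting λE from V and λ⁻¹E from V⁻¹
kills e₀ and leaves mutual inverses on its complement: both products equal the symmetric projection
1 − E. -/
theorem Input.pinv_gramPerp (hlam : 0 < I.lam) (x : ℕ → Vec d) (t : ℕ) :
    pinv (I.gramPerp x t) = (I.gramProj x t)⁻¹ - I.lam⁻¹ • outer (unitDir I.x₀) := by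
  refine IsMoorePenrose.unique (Classical.choose_spec (exists_isMoorePenrose _)) ?_
  have hV := I.gramProj_posDef hlam x t
  have hVE := I.gramProj_mul_outer x t
  have hEE := outer_unitDir_mul_self I.x₀
  have hEt := outer_isHermitian (unitDir I.x₀)
  rw [I.gramPerp_eq]
  set V := I.gramProj x t
  set E := outer (unitDir I.x₀)
  have hV1 := Matrix.mul_nonsing_inv V (isUnit_det hV)
  have hV2 := Matrix.nonsing_inv_mul V (isUnit_det hV)
  have hEV : E * V = I.lam • E := by
    have := congrArg Matrix.conjTranspose hVE
    rw [Matrix.conjTranspose_mul, hV.isHermitian.eq, hEt.eq, Matrix.conjTranspose_smul, hEt.eq]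
      at this
    simpa using this
  have hl : I.lam ≠ 0 := hlam.ne'
  have hVE' : V⁻¹ * E = I.lam⁻¹ • E := by
    have := congrArg (fun M => I.lam⁻¹ • (V⁻¹ * M)) hVE
    simp only [Matrix.mul_smul, ← Matrix.mul_assoc, hV2, Matrix.one_mul, smul_smul,
      inv_mul_cancel₀ hl, one_smul] at this
    exact this.symm
  have hEV' : E * V⁻¹ = I.lam⁻¹ • E := by
    have := congrArg (fun M => I.lam⁻¹ • (M * V⁻¹)) hEV
    simp only [Matrix.smul_mul, Matrix.mul_assoc, hV1, Matrix.mul_one, smul_smul,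
      inv_mul_cancel₀ hl, one_smul] at this
    exact this.symm
  have h1 : (V - I.lam • E) * (V⁻¹ - I.lam⁻¹ • E) = 1 - E := by
    simp only [Matrix.sub_mul, Matrix.mul_sub, Matrix.smul_mul, Matrix.mul_smul, hV1, hVE, hEV',
      hEE, smul_smul, mul_inv_cancel₀ hl, one_smul]
    simp
  have h2 : (V⁻¹ - I.lam⁻¹ • E) * (V - I.lam • E) = 1 - E := by
    simp only [Matrix.sub_mul, Matrix.mul_sub, Matrix.smul_mul, Matrix.mul_smul, hV2, hEV, hVE',
      hEE, smul_smul, inv_mul_cancel₀ hl, one_smul]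
    simp
  have hsym : (1 - E)ᵀ = 1 - E := by
    simpa using hEt.eq
  refine ⟨?_, ?_, by rw [h1, hsym], by rw [h2, hsym]⟩
  · rw [h1]
    simp only [Matrix.sub_mul, Matrix.mul_sub, Matrix.one_mul, Matrix.mul_smul, hEV, hEE]
    simp
  · rw [h2]
    simp only [Matrix.sub_mul, Matrix.mul_sub, Matrix.one_mul, Matrix.mul_smul, hEV', hEE]
    simp

theorem sum_smul_projPerp_mem (x₀ : Vec d) (a : ℕ → ℝ) (x : ℕ → Vec d) (t : ℕ) :
    ∑ s ∈ Finset.range t, a s • projPerp x₀ (x s) ∈ perpSpace x₀ :=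
  Submodule.sum_mem _ fun _ _ => Submodule.smul_mem _ _ (projPerp_mem _ _)

theorem Input.muHat_eq (hlam : 0 < I.lam) (x : ℕ → Vec d) (c : ℕ → ℝ) (t : ℕ) :
    I.muHat x c t = mulv (I.gramProj x t)⁻¹
      (∑ s ∈ Finset.range t, I.costPerp (x s) (c s) • projPerp I.x₀ (x s)) := by
  rw [Input.muHat, I.pinv_gramPerp hlam, sub_mulv, smul_mulv, outer_mulv,
    mem_perpSpace.1 (sum_smul_projPerp_mem _ _ _ _)]
  simp

theorem Input.inv_gramProj_mulv_mem (hlam : 0 < I.lam) (x : ℕ → Vec d) (t : ℕ) {v : Vec d}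
    (hv : v ∈ perpSpace I.x₀) : mulv (I.gramProj x t)⁻¹ v ∈ perpSpace I.x₀ := by
  have hV := I.gramProj_posDef hlam x t
  have h : inner ℝ (mulv (I.gramProj x t) (unitDir I.x₀)) (mulv (I.gramProj x t)⁻¹ v) = 0 := by
    rw [inner_mulv_symm hV.isHermitian, mulv_inv_mulv hV, mem_perpSpace.1 hv]
  rw [I.gramProj_mulv_unitDir, inner_smul_left] at h
  exact mem_perpSpace.2 ((mul_eq_zero.1 h).resolve_left (by simpa using hlam.ne'))

theorem Input.muHat_mem (hlam : 0 < I.lam) (x : ℕ → Vec d) (c : ℕ → ℝ) (t : ℕ) :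
    I.muHat x c t ∈ perpSpace I.x₀ := by
  rw [I.muHat_eq hlam]
  exact I.inv_gramProj_mulv_mem hlam x t (sum_smul_projPerp_mem _ _ _ _)

theorem Input.wnorm_gramPerp (x : ℕ → Vec d) (t : ℕ) {v : Vec d} (hv : v ∈ perpSpace I.x₀) :
    wnorm (I.gramPerp x t) v = wnorm (I.gramProj x t) v := by
  rw [wnorm_eq, wnorm_eq, I.gramPerp_eq, sub_mulv, smul_mulv, outer_mulv, mem_perpSpace.1 hv]
  simp

/-- A vector orthogonal to x₀ has the same inner products with actions and with their projections.
-/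
theorem Input.wnorm_gramProj (x : ℕ → Vec d) (t : ℕ) {v : Vec d} (hv : v ∈ perpSpace I.x₀) :
    wnorm (I.gramProj x t) v = wnorm (I.gram x t) v := by
  rw [wnorm_eq, wnorm_eq, Input.gramProj, I.inner_gram_mulv, I.inner_gram_mulv]
  simp only [inner_projPerp_left hv]

/-- By duality: the two primal norms agree on the complement of x₀, and the left side tests only
directions there. Concretely, Cauchy-Schwarz in the full Gram norm at V⁻¹ applied to the projection
gives N² ≤ W N. This lets cost widths be paid for by reward widths. -/
theorem Input.wnorm_inv_gramProj_projPerp_le (hlam : 0 < I.lam) (x : ℕ → Vec d) (t : ℕ)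
    (z : Vec d) :
    wnorm (I.gramProj x t)⁻¹ (projPerp I.x₀ z) ≤ wnorm (I.gram x t)⁻¹ z := by
  have hV := I.gramProj_posDef hlam x t
  have hv := I.inv_gramProj_mulv_mem hlam x t (projPerp_mem I.x₀ z)
  have h := inner_le_wnorm_mul_wnorm (I.gram_posDef hlam x t) z
    (mulv (I.gramProj x t)⁻¹ (projPerp I.x₀ z))
  rw [← I.wnorm_gramProj x t hv, wnorm_mulv_inv hV, ← inner_projPerp_left hv,
    ← wnorm_sq hV.inv] at h
  by_contra! hc
  have := wnorm_nonneg (I.gram x t)⁻¹ z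
  nlinarith

theorem Input.det_gramProj_le (hlam : 0 < I.lam) {x : ℕ → Vec d} {t : ℕ} {L : ℝ}
    (hx : ∀ s < t, ‖x s‖ ≤ L) :
    (I.gramProj x t).det / I.lam ^ d
      ≤ (1 + t * L ^ 2 / I.lam) ^ Module.finrank ℝ (perpSpace I.x₀) := by
  have hx' : ∀ s < t, ‖projPerp I.x₀ (x s)‖ ≤ L := fun s hs =>
    (norm_projPerp_le _ _).trans (hx s hs)
  by_cases h0 : I.x₀ = 0
  · rw [h0, finrank_perpSpace_zero]
    exact I.det_gram_le hlam hx'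
  have hk := finrank_perpSpace h0
  set k := Module.finrank ℝ (perpSpace I.x₀)
  have hV := I.gramProj_posDef hlam x t
  set c : ℝ := t * L ^ 2 with hc
  have hc0 : 0 ≤ c := by positivity
  -- Testing the matrix alone would give exponent d. Adding c e₀e₀ᵀ still leaves it below (λ + c)I,
  -- but multiplies the determinant by exactly 1 + c/λ; cancelling this factor lowers the exponent
  -- to d − 1.
  set f : Vec d := Real.sqrt c • unitDir I.x₀ with hf
  have hVe : mulv (I.gramProj x t)⁻¹ (unitDir I.x₀) = I.lam⁻¹ • unitDir I.x₀ := by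
    have := congrArg (mulv (I.gramProj x t)⁻¹) (I.gramProj_mulv_unitDir x t)
    rw [inv_mulv_mulv hV, mulv_smul] at this
    conv_rhs => rw [this]
    rw [inv_smul_smul₀ hlam.ne']
  have h1 := det_add_outer hV f
  have h2 : inner ℝ f (mulv (I.gramProj x t)⁻¹ f) = c / I.lam := by
    rw [hf, mulv_smul, hVe, inner_smul_left, inner_smul_right, inner_smul_right,
      real_inner_self_eq_norm_sq, norm_unitDir h0]
    have := Real.mul_self_sqrt hc0
    simp only [conj_trivial]
    rw [← mul_assoc, this]
    simp [div_eq_mul_inv]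
  rw [h2] at h1
  have h3 : (I.gramProj x t + outer f).det ≤ (I.lam + c) ^ d := by
    refine det_le_pow (posDef_add_outer hV f) fun v => ?_
    rw [add_mulv, inner_add_right, outer_mulv, inner_smul_right, Input.gramProj,
      I.inner_gram_mulv]
    have h4 : ∑ s ∈ Finset.range t, inner ℝ (projPerp I.x₀ (x s)) v ^ 2
        ≤ c * ‖projPerp I.x₀ v‖ ^ 2 := by
      calc _ ≤ ∑ _s ∈ Finset.range t, L ^ 2 * ‖projPerp I.x₀ v‖ ^ 2 := by
            refine Finset.sum_le_sum fun s hs => ?_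
            have h5 := hx' s (Finset.mem_range.1 hs)
            rw [← mul_pow, ← sq_abs, real_inner_comm,
              ← inner_projPerp_left (projPerp_mem I.x₀ (x s)), real_inner_comm]
            gcongr
            exact (abs_real_inner_le_norm _ _).trans (by gcongr)
        _ = _ := by simp [hc, mul_assoc]
    have h6 : ‖projPerp I.x₀ v‖ ^ 2 = ‖v‖ ^ 2 - inner ℝ (unitDir I.x₀) v ^ 2 := by
      rw [← real_inner_self_eq_norm_sq, inner_projPerp_left (projPerp_mem _ _), projPerp_eq,
        inner_sub_right, inner_smul_right, real_inner_self_eq_norm_sq, real_inner_comm v, sq]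
      ring
    have h7 : inner ℝ f v * inner ℝ v f = c * inner ℝ (unitDir I.x₀) v ^ 2 := by
      rw [real_inner_comm f v, hf, inner_smul_left]
      have := Real.mul_self_sqrt hc0
      simp only [conj_trivial]
      calc _ = (Real.sqrt c * Real.sqrt c) * inner ℝ (unitDir I.x₀) v ^ 2 := by ring
        _ = _ := by rw [this]
    rw [h7]
    rw [h6] at h4
    linarith
  rw [h1] at h3
  have h8 : (0 : ℝ) < 1 + c / I.lam := by positivity
  have h9 : (I.lam + c) ^ d = I.lam ^ d * (1 + c / I.lam) ^ k * (1 + c / I.lam) := by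
    rw [mul_assoc, ← pow_succ, hk, ← mul_pow]
    congr 1
    field_simp
  rw [h9] at h3
  rw [div_le_iff₀ (by positivity), mul_comm _ (I.lam ^ d)]
  exact le_of_mul_le_mul_right h3 h8

/-- The cost along e₀ is known, because ⟨e₀, μ_*⟩ = c₀/‖x₀‖ (both sides 0 if x₀ = 0). Subtracting it
leaves a linear model in the projected action with unchanged noise. -/
theorem Input.costPerp_signal {μs : Vec d} (hc₀ : inner ℝ I.x₀ μs = I.c₀) (x : Vec d) (y : ℝ) :
    I.costPerp x (inner ℝ x μs + y)
      = inner ℝ (projPerp I.x₀ x) (projPerp I.x₀ μs) + y := by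
  rw [inner_projPerp_left (projPerp_mem _ _), Input.costPerp, projPerp_eq, inner_sub_right,
    inner_smul_right, real_inner_comm (unitDir I.x₀) μs, inner_unitDir_eq, hc₀]
  ring

end Perp

/-! ### Ville's inequality and the one-step Gaussian mixture. -/

section Supermartingale

open scoped ENNReal

variable {Ω : Type*} {m mΩ : MeasurableSpace Ω} {P : Measure Ω}

/-- On m, the measure with density g is at most c times P. Stating the bound with lower integrals
avoids any integrability requirement on f. -/
theorem lintegral_mul_le_of_condExp_le [IsFiniteMeasure P] (hm : m ≤ mΩ)
    {g : Ω → ℝ} (hg : Integrable g P) (hg0 : 0 ≤ g) {c : ℝ}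
    (hc : P[g | m] ≤ᵐ[P] fun _ => c) {f : Ω → ℝ≥0∞} (hf : Measurable[m] f) :
    ∫⁻ ω, f ω * ENNReal.ofReal (g ω) ∂P ≤ ENNReal.ofReal c * ∫⁻ ω, f ω ∂P := by
  have hgm : AEMeasurable (fun ω => ENNReal.ofReal (g ω)) P := hg.aemeasurable.ennreal_ofReal
  have hle : (P.withDensity fun ω => ENNReal.ofReal (g ω)).trim hm
      ≤ ENNReal.ofReal c • P.trim hm := by
    refine Measure.le_iff.2 fun s hs => ?_
    rw [Measure.smul_apply, trim_measurableSet_eq hm hs, trim_measurableSet_eq hm hs,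
      withDensity_apply _ (hm s hs), smul_eq_mul,
      ← ofReal_integral_eq_lintegral_ofReal hg.integrableOn (ae_of_all _ hg0),
      ← setIntegral_condExp hm hg hs]
    have h1 : ∫ ω in s, (P[g | m]) ω ∂P ≤ ∫ _ω in s, c ∂P :=
      setIntegral_mono_ae integrable_condExp.integrableOn (integrable_const _).integrableOn hc
    by_cases hs0 : P s = 0
    · simp [Measure.restrict_eq_zero.2 hs0]
    refine (ENNReal.ofReal_le_ofReal h1).trans ?_
    rw [setIntegral_const, smul_eq_mul, mul_comm, ENNReal.ofReal_mul' measureReal_nonneg,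
      ofReal_measureReal]
  calc ∫⁻ ω, f ω * ENNReal.ofReal (g ω) ∂P
      = ∫⁻ ω, f ω ∂(P.withDensity fun ω => ENNReal.ofReal (g ω)) := by
        rw [lintegral_withDensity_eq_lintegral_mul₀ hgm (hf.mono hm le_rfl).aemeasurable]
        simp [mul_comm]
    _ = ∫⁻ ω, f ω ∂(P.withDensity fun ω => ENNReal.ofReal (g ω)).trim hm :=
        (lintegral_trim hm hf).symm
    _ ≤ ∫⁻ ω, f ω ∂(ENNReal.ofReal c • P.trim hm) := lintegral_mono' hle le_rfl
    _ = _ := by rw [lintegral_smul_measure, lintegral_trim hm hf, smul_eq_mul]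

/-- Ville's maximal inequality for a nonnegative supermartingale. -/
theorem mul_measure_exists_le_le_one {𝓗 : Filtration ℕ mΩ} {M : ℕ → Ω → ℝ≥0∞} {T : ℕ}
    (hM : ∀ t ≤ T, Measurable[𝓗 t] (M t)) (h0 : ∫⁻ ω, M 0 ω ∂P ≤ 1)
    (hstep : ∀ t < T, ∀ f : Ω → ℝ≥0∞, Measurable[𝓗 t] f →
      ∫⁻ ω, f ω * M (t + 1) ω ∂P ≤ ∫⁻ ω, f ω * M t ω ∂P) (c : ℝ≥0∞) :
    c * P {ω | ∃ t ≤ T, c ≤ M t ω} ≤ 1 := by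
  have hmeas : ∀ n ≤ T, MeasurableSet[𝓗 n] {ω | ∃ t ≤ n, c ≤ M t ω} := by
    intro n hn
    have : {ω | ∃ t ≤ n, c ≤ M t ω} = ⋃ t ∈ Finset.range (n + 1), {ω | c ≤ M t ω} := by
      ext ω; simp
    rw [this]
    refine Finset.measurableSet_biUnion _ fun t ht => ?_
    have ht' : t ≤ n := Nat.lt_succ_iff.1 (Finset.mem_range.1 ht)
    exact 𝓗.mono ht' _ (hM t (ht'.trans hn) measurableSet_Ici)
  -- Optional stopping at the first crossing of c, in inductive form: crossed paths are charged c,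
  -- the others keep their current value.
  have key : ∀ n ≤ T, c * P {ω | ∃ t ≤ n, c ≤ M t ω}
      + ∫⁻ ω in {ω | ∃ t ≤ n, c ≤ M t ω}ᶜ, M n ω ∂P ≤ 1 := by
    intro n
    induction n with
    | zero =>
      intro hn
      have hm := 𝓗.le 0 _ (hmeas 0 hn)
      refine le_trans ?_ h0
      rw [← lintegral_add_compl (μ := P) (M 0) hm]
      refine add_le_add ?_ le_rfl
      rw [← setLIntegral_const]
      refine setLIntegral_mono' hm fun ω hω => ?_
      obtain ⟨t, ht, h⟩ := hω
      rwa [Nat.le_zero.1 ht] at h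
    | succ n ih =>
      intro hn
      have hn' : n ≤ T := by omega
      have hm := 𝓗.le _ _ (hmeas n hn')
      have hm1 := 𝓗.le _ _ (hmeas (n + 1) hn)
      set B := {ω | ∃ t ≤ n, c ≤ M t ω} with hB
      set B' := {ω | ∃ t ≤ n + 1, c ≤ M t ω} with hB'
      have hsub : B ⊆ B' := fun ω ⟨t, ht, h⟩ => ⟨t, by omega, h⟩
      have hind : Measurable[𝓗 n] (Bᶜ.indicator fun _ => (1 : ℝ≥0∞)) :=
        Measurable.indicator measurable_const (MeasurableSet.compl (hmeas n hn'))
      have h1 := hstep n (by omega) _ hind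
      have h2 : ∀ g : Ω → ℝ≥0∞, ∫⁻ ω, (Bᶜ.indicator (fun _ => 1) : Ω → ℝ≥0∞) ω * g ω ∂P
          = ∫⁻ ω in Bᶜ, g ω ∂P := by
        intro g
        rw [← lintegral_indicator hm.compl]
        congr 1
        ext ω
        by_cases hω : ω ∈ Bᶜ <;> simp [hω]
      rw [h2, h2] at h1
      refine le_trans ?_ (ih hn')
      have h3 : ∫⁻ ω in Bᶜ, M (n + 1) ω ∂P
          = ∫⁻ ω in B' \ B, M (n + 1) ω ∂P + ∫⁻ ω in B'ᶜ, M (n + 1) ω ∂P := by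
        rw [← lintegral_union hm1.compl]
        · congr 2
          ext ω
          simp only [Set.mem_compl_iff, Set.mem_union, Set.mem_sdiff]
          have := @hsub ω
          tauto
        · exact Set.disjoint_left.2 fun ω h h' => h' h.1
      have h4 : c * P (B' \ B) ≤ ∫⁻ ω in B' \ B, M (n + 1) ω ∂P := by
        rw [← setLIntegral_const]
        refine setLIntegral_mono' (hm1.diff hm) fun ω hω => ?_
        obtain ⟨⟨t, ht, h⟩, hω2⟩ := hω
        rcases Nat.lt_or_ge t (n + 1) with h5 | h5
        · exact absurd ⟨t, by omega, h⟩ hω2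
        · rwa [show t = n + 1 by omega] at h
      calc c * P B' + ∫⁻ ω in B'ᶜ, M (n + 1) ω ∂P
          = c * P B + (c * P (B' \ B) + ∫⁻ ω in B'ᶜ, M (n + 1) ω ∂P) := by
            rw [← add_assoc, ← mul_add, measure_add_sdiff hm.nullMeasurableSet,
              Set.union_eq_self_of_subset_left hsub]
        _ ≤ c * P B + ∫⁻ ω in Bᶜ, M (n + 1) ω ∂P := by
            rw [h3]; gcongr
        _ ≤ _ := by gcongr
  exact le_trans le_self_add (key T le_rfl)

/-- The likelihood ratio of an observation `y` under the prior `N(u, w)` on the mean of a standard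
Gaussian, relative to the standard Gaussian. -/
noncomputable def mixtureRatio (u w y : ℝ) : ℝ :=
  (Real.sqrt (1 + w))⁻¹ * Real.exp ((2 * u * y + w * y ^ 2 - u ^ 2) / (2 * (1 + w)))

/-- Bayes' rule for a Gaussian prior and standard Gaussian noise, by completing the square:
likelihood times prior is evidence times posterior. -/
theorem gaussianPDFReal_mul_exp {w : ℝ} (hw : 0 < w) (u y a : ℝ) :
    gaussianPDFReal u w.toNNReal a * Real.exp (a * y - a ^ 2 / 2)
      = mixtureRatio u w y * gaussianPDFReal ((u + w * y) / (1 + w)) (w / (1 + w)).toNNReal a := by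
  have hw1 : 0 < 1 + w := by positivity
  rw [gaussianPDFReal, gaussianPDFReal, mixtureRatio, Real.coe_toNNReal _ hw.le,
    Real.coe_toNNReal _ (by positivity)]
  have h1 : Real.sqrt (2 * Real.pi * w)
      = Real.sqrt (1 + w) * Real.sqrt (2 * Real.pi * (w / (1 + w))) := by
    rw [← Real.sqrt_mul hw1.le]
    congr 1
    field_simp
  rw [h1, mul_inv, mul_assoc, mul_assoc, mul_assoc, mul_assoc, mul_left_comm (Real.exp _),
    ← Real.exp_add, ← Real.exp_add]
  congr 3
  field_simp
  ring

theorem lintegral_gaussianPDF_mul_exp {w : ℝ} (hw : 0 < w) (u y : ℝ) :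
    ∫⁻ a : ℝ, gaussianPDF u w.toNNReal a * ENNReal.ofReal (Real.exp (a * y - a ^ 2 / 2))
      = ENNReal.ofReal (mixtureRatio u w y) := by
  have hq : 0 ≤ mixtureRatio u w y := by rw [mixtureRatio]; positivity
  calc _ = ∫⁻ a : ℝ, ENNReal.ofReal (mixtureRatio u w y)
        * gaussianPDF ((u + w * y) / (1 + w)) (w / (1 + w)).toNNReal a := by
        refine lintegral_congr fun a => ?_
        rw [gaussianPDF, gaussianPDF, ← ENNReal.ofReal_mul (gaussianPDFReal_nonneg _ _ _),
          ← ENNReal.ofReal_mul hq, gaussianPDFReal_mul_exp hw]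
    _ = _ := by
        rw [lintegral_const_mul _ (measurable_gaussianPDF _ _), lintegral_gaussianPDF_eq_one,
          mul_one]
        exact (Real.toNNReal_pos.2 (by positivity)).ne'

theorem measurable_gaussianPDF_toNNReal :
    Measurable fun p : ℝ × ℝ × ℝ => gaussianPDF p.1 p.2.1.toNNReal p.2.2 := by
  simp only [gaussianPDF, gaussianPDFReal]
  refine Measurable.ennreal_ofReal (Measurable.mul ?_ ?_) <;> fun_prop

/-- The ratio is the N(u, w)-average over a of exp(aξ − a²/2), and each of these has conditional
mean at most 1. As u and w are m-measurable, Tonelli allows conditioning at fixed a. -/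
theorem lintegral_mul_mixtureRatio_le [IsProbabilityMeasure P]
    (hm : m ≤ mΩ) {ξ : Ω → ℝ} (hξm : Measurable ξ) (hξ : CondSubGaussian P m ξ 1)
    {u w : Ω → ℝ} (hu : Measurable[m] u) (hw : Measurable[m] w) (hw0 : ∀ ω, 0 ≤ w ω)
    (huw : ∀ ω, w ω = 0 → u ω = 0) {f : Ω → ℝ≥0∞} (hf : Measurable[m] f) :
    ∫⁻ ω, f ω * ENNReal.ofReal (mixtureRatio (u ω) (w ω) (ξ ω)) ∂P ≤ ∫⁻ ω, f ω ∂P := by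
  set s : Set Ω := {ω | 0 < w ω} with hs
  have hsm : MeasurableSet[m] s := hw measurableSet_Ioi
  have hsm' := hm s hsm
  rw [← lintegral_add_compl _ hsm', ← lintegral_add_compl f hsm']
  refine add_le_add ?_ (le_of_eq ?_)
  swap
  -- Where w = 0 the prior has no density, but then u = 0 and the ratio is 1.
  · refine setLIntegral_congr_fun hsm'.compl fun ω hω => ?_
    have h1 : w ω = 0 := le_antisymm (not_lt.1 hω) (hw0 ω)
    simp [mixtureRatio, h1, huw ω h1]
  have hu' := hu.mono hm le_rfl
  have hw' := hw.mono hm le_rfl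
  have hf' := hf.mono hm le_rfl
  have hgm1 : Measurable (fun p : Ω × ℝ => gaussianPDF (u p.1) (w p.1).toNNReal p.2) :=
    measurable_gaussianPDF_toNNReal.comp ((hu'.comp measurable_fst).prodMk
      ((hw'.comp measurable_fst).prodMk measurable_snd))
  have hgm2 : ∀ a : ℝ, Measurable[m] fun ω => gaussianPDF (u ω) (w ω).toNNReal a := fun a =>
    measurable_gaussianPDF_toNNReal.comp (hu.prodMk (hw.prodMk measurable_const))
  calc ∫⁻ ω in s, f ω * ENNReal.ofReal (mixtureRatio (u ω) (w ω) (ξ ω)) ∂P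
      = ∫⁻ ω in s, (∫⁻ a : ℝ, f ω * (gaussianPDF (u ω) (w ω).toNNReal a
          * ENNReal.ofReal (Real.exp (a * ξ ω - a ^ 2 / 2)))) ∂P := by
        refine setLIntegral_congr_fun hsm' fun ω hω => ?_
        rw [lintegral_const_mul, lintegral_gaussianPDF_mul_exp hω]
        exact (measurable_gaussianPDF _ _).mul (by fun_prop)
    _ = ∫⁻ a : ℝ, ∫⁻ ω in s, f ω * (gaussianPDF (u ω) (w ω).toNNReal a
          * ENNReal.ofReal (Real.exp (a * ξ ω - a ^ 2 / 2))) ∂P := by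
        refine lintegral_lintegral_swap (Measurable.aemeasurable ?_)
        refine (hf'.comp measurable_fst).mul (hgm1.mul ?_)
        fun_prop
    _ ≤ ∫⁻ a : ℝ, ∫⁻ ω in s, f ω * gaussianPDF (u ω) (w ω).toNNReal a ∂P := by
        refine lintegral_mono fun a => ?_
        have hind : Measurable[m] (s.indicator fun ω =>
            f ω * gaussianPDF (u ω) (w ω).toNNReal a) :=
          Measurable.indicator (Measurable.mul hf (hgm2 a)) hsm
        have h1 := lintegral_mul_le_of_condExp_le hm (hξ.integrable_exp a)
          (fun ω => (Real.exp_pos _).le) (hξ.mgf_le a) hind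
        have h2 : ∀ ω, f ω * (gaussianPDF (u ω) (w ω).toNNReal a
            * ENNReal.ofReal (Real.exp (a * ξ ω - a ^ 2 / 2)))
            = ENNReal.ofReal (Real.exp (-(a ^ 2 / 2))) * (f ω * gaussianPDF (u ω) (w ω).toNNReal a
              * ENNReal.ofReal (Real.exp (a * ξ ω))) := by
          intro ω
          rw [sub_eq_add_neg, Real.exp_add, ENNReal.ofReal_mul (Real.exp_pos _).le]
          ring
        simp_rw [h2]
        rw [lintegral_const_mul' _ _ ENNReal.ofReal_ne_top, ← lintegral_indicator hsm',
          ← lintegral_indicator hsm']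
        have h3 : ∀ ω, s.indicator (fun ω => f ω * gaussianPDF (u ω) (w ω).toNNReal a
              * ENNReal.ofReal (Real.exp (a * ξ ω))) ω
            = s.indicator (fun ω => f ω * gaussianPDF (u ω) (w ω).toNNReal a) ω
              * ENNReal.ofReal (Real.exp (a * ξ ω)) := fun ω => Set.indicator_mul_left _ _ _
        simp_rw [h3]
        refine (mul_le_mul_right h1 _).trans ?_
        rw [← mul_assoc, ← ENNReal.ofReal_mul (Real.exp_pos _).le, ← Real.exp_add]
        simp
    _ = ∫⁻ ω in s, (∫⁻ a : ℝ, f ω * gaussianPDF (u ω) (w ω).toNNReal a) ∂P := by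
        symm
        exact lintegral_lintegral_swap
          (((hf'.comp measurable_fst).mul hgm1).aemeasurable)
    _ = ∫⁻ ω in s, f ω ∂P := by
        refine setLIntegral_congr_fun hsm' fun ω hω => ?_
        rw [lintegral_const_mul _ (measurable_gaussianPDF _ _), lintegral_gaussianPDF_eq_one,
          mul_one]
        exact (Real.toNNReal_pos.2 hω).ne'

end Supermartingale

/-! ### Measurability of inverses, weighted norms and projections. -/

section Measurability

variable {β : Type*} {_ : MeasurableSpace β} {d : ℕ}

theorem measurable_det {n : Type*} [Fintype n] [DecidableEq n] {A : β → Matrix n n ℝ}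
    (hA : ∀ i j, Measurable fun b => A b i j) : Measurable fun b => (A b).det := by
  simp only [Matrix.det_apply]
  exact Finset.measurable_sum _ fun σ _ =>
    (Finset.measurable_prod _ fun i _ => hA _ _).const_smul _

theorem measurable_inv_apply {A : β → Matrix (Fin d) (Fin d) ℝ}
    (hA : ∀ i j, Measurable fun b => A b i j) (i j : Fin d) :
    Measurable fun b => (A b)⁻¹ i j := by
  simp only [Matrix.inv_def, Matrix.smul_apply, Ring.inverse_eq_inv', smul_eq_mul,
    Matrix.adjugate_apply]
  refine (measurable_det hA).inv.mul (measurable_det fun k l => ?_)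
  by_cases hk : k = j
  · subst hk; simp
  · simpa [Matrix.updateRow_ne hk] using hA k l

theorem measurable_inner_mulv {A : β → Matrix (Fin d) (Fin d) ℝ}
    (hA : ∀ i j, Measurable fun b => A b i j) {u v : β → Vec d} (hu : Measurable u)
    (hv : Measurable v) : Measurable fun b => inner ℝ (u b) (mulv (A b) (v b)) := by
  have hc : ∀ {w : β → Vec d}, Measurable w → ∀ i, Measurable fun b => (w b).ofLp i :=
    fun hw i => (EuclideanSpace.proj (𝕜 := ℝ) i).measurable.comp hw
  simp only [inner_mulv, dotProduct, Matrix.mulVec]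
  exact Finset.measurable_sum _ fun i _ => (hc hu i).mul
    (Finset.measurable_sum _ fun j _ => (hA i j).mul (hc hv j))

theorem measurable_wnorm {A : β → Matrix (Fin d) (Fin d) ℝ}
    (hA : ∀ i j, Measurable fun b => A b i j) {v : β → Vec d} (hv : Measurable v) :
    Measurable fun b => wnorm (A b) (v b) := by
  simp only [wnorm_eq]
  exact (measurable_inner_mulv hA hv hv).sqrt

theorem Input.measurable_gram_apply (I : Input d) {x : ℕ → β → Vec d} {t : ℕ}
    (hx : ∀ s < t, Measurable (x s)) (i j : Fin d) :
    Measurable fun b => I.gram (fun s => x s b) t i j := by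
  have hc : ∀ s < t, ∀ i, Measurable fun b => (x s b).ofLp i :=
    fun s hs i => (EuclideanSpace.proj (𝕜 := ℝ) i).measurable.comp (hx s hs)
  simp only [Input.gram, Matrix.add_apply, Matrix.sum_apply, outer, Matrix.vecMulVec_apply]
  exact measurable_const.add (Finset.measurable_sum _ fun s hs =>
    (hc s (Finset.mem_range.1 hs) i).mul (hc s (Finset.mem_range.1 hs) j))

theorem measurable_projPerp (x₀ : Vec d) : Measurable (projPerp x₀) := by
  unfold projPerp projO
  exact Continuous.measurable (by fun_prop)

end Measurability

/-! ### Self-normalized concentration. -/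

section SelfNormalized

open scoped ENNReal

variable {Ω : Type*} {m mΩ : MeasurableSpace Ω} {P : Measure Ω} {d : ℕ} (I : Input d)

/-- The self-normalized exponential of the weighted noise sum. -/
noncomputable def Input.selfNormExp (x : ℕ → Vec d) (ξ : ℕ → ℝ) (t : ℕ) : ℝ :=
  Real.sqrt (I.lam ^ d / (I.gram x t).det)
    * Real.exp (inner ℝ (∑ s ∈ Finset.range t, ξ s • x s)
        (mulv (I.gram x t)⁻¹ (∑ s ∈ Finset.range t, ξ s • x s)) / 2)

theorem Input.selfNormExp_zero (hlam : 0 < I.lam) (x : ℕ → Vec d) (ξ : ℕ → ℝ) :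
    I.selfNormExp x ξ 0 = 1 := by
  simp [Input.selfNormExp, I.det_gram_zero, (pow_pos hlam d).ne']

theorem Input.selfNormExp_succ (hlam : 0 < I.lam) (x : ℕ → Vec d) (ξ : ℕ → ℝ) (t : ℕ) :
    I.selfNormExp x ξ (t + 1) = I.selfNormExp x ξ t
      * mixtureRatio (inner ℝ (x t) (mulv (I.gram x t)⁻¹ (∑ s ∈ Finset.range t, ξ s • x s)))
        (inner ℝ (x t) (mulv (I.gram x t)⁻¹ (x t))) (ξ t) := by
  have hV := I.gram_posDef hlam x t
  have hw := inner_mulv_self_nonneg hV.inv (x t)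
  have hdet := hV.det_pos
  rw [Input.selfNormExp, Finset.sum_range_succ, I.gram_succ, inner_inv_add_outer hV,
    det_add_outer hV, ← div_div, div_eq_mul_inv (_ / _) (1 + _),
    Real.sqrt_mul (by positivity), Real.sqrt_inv, add_div, Real.exp_add, Input.selfNormExp,
    mixtureRatio, div_div, mul_comm (1 + _) (2 : ℝ)]
  ring

theorem Input.selfNormExp_eq_exp (hlam : 0 < I.lam) (x : ℕ → Vec d) (ξ : ℕ → ℝ) (t : ℕ) :
    I.selfNormExp x ξ t = Real.exp ((wnorm (I.gram x t)⁻¹ (∑ s ∈ Finset.range t, ξ s • x s) ^ 2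
      - Real.log ((I.gram x t).det / I.lam ^ d)) / 2) := by
  have hV := I.gram_posDef hlam x t
  have hdet := hV.det_pos
  rw [Input.selfNormExp, wnorm_sq hV.inv, sub_eq_neg_add, add_div, Real.exp_add, ← Real.log_inv,
    inv_div, Real.exp_half, Real.exp_half, Real.exp_log (by positivity)]

theorem Input.measurable_selfNormExp {x : ℕ → Ω → Vec d} {ξ : ℕ → Ω → ℝ}
    {t : ℕ} (hx : ∀ s < t, Measurable[m] (x s)) (hξ : ∀ s < t, Measurable[m] (ξ s)) :
    Measurable[m] fun ω => I.selfNormExp (fun s => x s ω) (fun s => ξ s ω) t := by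
  have hA := I.measurable_gram_apply hx
  have hS : Measurable[m] fun ω => ∑ s ∈ Finset.range t, ξ s ω • x s ω :=
    Finset.measurable_sum _ fun s hs =>
      (hξ s (Finset.mem_range.1 hs)).smul (hx s (Finset.mem_range.1 hs))
  have h1 := measurable_det hA
  have h2 := measurable_inner_mulv (measurable_inv_apply hA) hS hS
  exact (Real.continuous_sqrt.measurable.comp (measurable_const.div h1)).mul
    (Real.measurable_exp.comp (h2.div_const 2))

theorem Input.measure_exists_selfNormExp_ge_le [IsProbabilityMeasure P] (hlam : 0 < I.lam)
    {𝓗 : Filtration ℕ mΩ} {𝓖 : ℕ → MeasurableSpace Ω} {T : ℕ} {x : ℕ → Ω → Vec d}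
    {ξ : ℕ → Ω → ℝ} (h𝓖 : ∀ t < T, 𝓗 t ≤ 𝓖 t) (h𝓖' : ∀ t < T, 𝓖 t ≤ mΩ)
    (hx : ∀ t < T, Measurable[𝓗 (t + 1)] (x t)) (hξ : ∀ t < T, Measurable[𝓗 (t + 1)] (ξ t))
    (hx' : ∀ t < T, Measurable[𝓖 t] (x t))
    (hsub : ∀ t < T, CondSubGaussian P (𝓖 t) (ξ t) 1) (c : ℝ≥0∞) :
    c * P {ω | ∃ t ≤ T, c ≤ ENNReal.ofReal (I.selfNormExp (fun s => x s ω) (fun s => ξ s ω) t)}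
      ≤ 1 := by
  have hx1 : ∀ t ≤ T, ∀ s < t, Measurable[𝓗 t] (x s) := fun t ht s hs =>
    (hx s (by omega)).mono (𝓗.mono (by omega)) le_rfl
  have hξ1 : ∀ t ≤ T, ∀ s < t, Measurable[𝓗 t] (ξ s) := fun t ht s hs =>
    (hξ s (by omega)).mono (𝓗.mono (by omega)) le_rfl
  refine mul_measure_exists_le_le_one (𝓗 := 𝓗) (P := P) (T := T) (M := fun t ω =>
    ENNReal.ofReal (I.selfNormExp (fun s => x s ω) (fun s => ξ s ω) t)) ?_ ?_ ?_ c
  · exact fun t ht => (I.measurable_selfNormExp (hx1 t ht) (hξ1 t ht)).ennreal_ofReal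
  · simp [I.selfNormExp_zero hlam]
  · intro t ht f hf
    have hM := (I.measurable_selfNormExp (hx1 t ht.le) (hξ1 t ht.le)).ennreal_ofReal
    have hx2 : ∀ s < t, Measurable[𝓖 t] (x s) := fun s hs =>
      (hx1 t ht.le s hs).mono (h𝓖 t ht) le_rfl
    have hS : Measurable[𝓖 t] fun ω => ∑ s ∈ Finset.range t, ξ s ω • x s ω :=
      Finset.measurable_sum _ fun s hs => ((hξ1 t ht.le s (Finset.mem_range.1 hs)).mono
        (h𝓖 t ht) le_rfl).smul (hx2 s (Finset.mem_range.1 hs))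
    have hA := measurable_inv_apply (I.measurable_gram_apply hx2)
    have hV := fun ω => (I.gram_posDef hlam (fun s => x s ω) t).inv
    have h := lintegral_mul_mixtureRatio_le (P := P) (h𝓖' t ht)
      ((hξ t ht).mono (𝓗.le _) le_rfl) (hsub t ht)
      (measurable_inner_mulv hA (hx' t ht) hS) (measurable_inner_mulv hA (hx' t ht) (hx' t ht))
      (fun ω => inner_mulv_self_nonneg (hV ω) _) (fun ω h0 => ?_)
      ((hf.mul hM).mono (h𝓖 t ht) le_rfl)
    · refine le_trans (le_of_eq (lintegral_congr fun ω => ?_)) h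
      rw [I.selfNormExp_succ hlam, ENNReal.ofReal_mul, ← mul_assoc]
      · rfl
      · rw [Input.selfNormExp]; positivity
    · have : x t ω = 0 := by
        by_contra hne
        exact ((posDef_iff_inner.1 (hV ω)).2 _ hne).ne' h0
      rw [this, inner_zero_left]

theorem CondSubGaussian.div {ξ : Ω → ℝ} {R : ℝ} (hR : 0 < R)
    (h : CondSubGaussian P m ξ R) :
    CondSubGaussian P m (fun ω => ξ ω / R) 1 := by
  have he : ∀ a : ℝ, (fun ω => Real.exp (a * (ξ ω / R))) = fun ω => Real.exp (a / R * ξ ω) := by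
    intro a; funext ω; congr 1; ring
  refine ⟨h.integrable.div_const R, fun a => ?_, ?_, fun a => ?_⟩
  · rw [he]; exact h.integrable_exp _
  · have h1 : (fun ω => ξ ω / R) = R⁻¹ • ξ := by
      funext ω; simp [div_eq_inv_mul]
    rw [h1]
    refine (condExp_smul _ _ _).trans ?_
    filter_upwards [h.centred] with ω hω
    simp [hω]
  · rw [he]
    filter_upwards [h.mgf_le (a / R)] with ω hω
    refine hω.trans (le_of_eq ?_)
    congr 1
    field_simp

/-- The exponential moments at ±1 force the mean of cosh ξ to be at most 1, while cosh ≥ 1 with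
equality only at 0. This covers R = 0, where the noise cannot be rescaled. -/
theorem CondSubGaussian.ae_eq_zero [IsProbabilityMeasure P] (hm : m ≤ mΩ)
    {ξ : Ω → ℝ} (h : CondSubGaussian P m ξ 0) : ∀ᵐ ω ∂P, ξ ω = 0 := by
  have h1 : ∀ a : ℝ, ∫ ω, Real.exp (a * ξ ω) ∂P ≤ 1 := by
    intro a
    rw [← integral_condExp hm]
    calc _ ≤ ∫ _ω, (1 : ℝ) ∂P := by
          refine integral_mono_ae integrable_condExp (integrable_const _) ?_
          filter_upwards [h.mgf_le a] with ω hω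
          simpa using hω
      _ = 1 := by simp
  have hi : Integrable (fun ω => Real.exp (1 * ξ ω) + Real.exp (-1 * ξ ω)) P :=
    (h.integrable_exp 1).add (h.integrable_exp (-1))
  have h2 : ∀ ω, Real.exp (1 * ξ ω) + Real.exp (-1 * ξ ω) = 2 * Real.cosh (ξ ω) := by
    intro ω; rw [Real.cosh_eq]; ring_nf
  have h3 : 0 ≤ fun ω => Real.exp (1 * ξ ω) + Real.exp (-1 * ξ ω) - 2 := by
    intro ω
    have := Real.one_le_cosh (ξ ω)
    simp only [h2, Pi.zero_apply]
    linarith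
  have h4 : ∫ ω, (Real.exp (1 * ξ ω) + Real.exp (-1 * ξ ω) - 2) ∂P = 0 := by
    refine le_antisymm ?_ (integral_nonneg h3)
    rw [integral_sub hi (integrable_const _),
      integral_add (h.integrable_exp 1) (h.integrable_exp (-1))]
    have := h1 1
    have := h1 (-1)
    simp only [integral_const, probReal_univ, one_smul]
    linarith
  have h5 := (integral_eq_zero_iff_of_nonneg h3 (hi.sub (integrable_const _))).1 h4
  filter_upwards [h5] with ω hω
  by_contra hne
  have := Real.one_lt_cosh.2 hne
  simp only [h2, Pi.zero_apply] at hω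
  linarith

/-- The self-normalized concentration inequality, uniformly in time. -/
theorem Input.measure_exists_lt_wnorm_le [IsProbabilityMeasure P] (hlam : 0 < I.lam)
    {𝓗 : Filtration ℕ mΩ} {𝓖 : ℕ → MeasurableSpace Ω} {T : ℕ} {x : ℕ → Ω → Vec d}
    {ξ : ℕ → Ω → ℝ} {R : ℝ} (hR : 0 ≤ R)
    (h𝓖 : ∀ t < T, 𝓗 t ≤ 𝓖 t) (h𝓖' : ∀ t < T, 𝓖 t ≤ mΩ)
    (hx : ∀ t < T, Measurable[𝓗 (t + 1)] (x t)) (hξ : ∀ t < T, Measurable[𝓗 (t + 1)] (ξ t))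
    (hx' : ∀ t < T, Measurable[𝓖 t] (x t))
    (hsub : ∀ t < T, CondSubGaussian P (𝓖 t) (ξ t) R) {ε : ℝ} (hε : 0 < ε) :
    P {ω | ∃ t ≤ T, R * Real.sqrt (Real.log ((I.gram (fun s => x s ω) t).det / I.lam ^ d)
        + 2 * Real.log (1 / ε))
          < wnorm (I.gram (fun s => x s ω) t)⁻¹ (∑ s ∈ Finset.range t, ξ s ω • x s ω)}
      ≤ ENNReal.ofReal ε := by
  rcases hR.eq_or_lt with hR0 | hR0
  · subst hR0
    have hz : ∀ᵐ ω ∂P, ∀ t < T, ξ t ω = 0 := by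
      rw [ae_all_iff]
      intro t
      by_cases ht : t < T
      · filter_upwards [(hsub t ht).ae_eq_zero (h𝓖' t ht)] with ω hω _ using hω
      · exact ae_of_all _ fun ω h => absurd h ht
    refine le_of_eq_of_le (measure_mono_null ?_ hz) zero_le
    intro ω hω h0
    obtain ⟨t, ht, h⟩ := hω
    rw [Finset.sum_eq_zero fun s hs => by
      rw [h0 s ((Finset.mem_range.1 hs).trans_le ht), zero_smul]] at h
    simp [wnorm] at h
  · have h := I.measure_exists_selfNormExp_ge_le (P := P) hlam (ξ := fun t ω => ξ t ω / R) h𝓖 h𝓖' hx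
      (fun t ht => (hξ t ht).div_const R) hx' (fun t ht => (hsub t ht).div hR0)
      (ENNReal.ofReal (1 / ε))
    rw [one_div, ENNReal.ofReal_inv_of_pos hε, ENNReal.inv_mul_le_iff
      (ENNReal.ofReal_pos.2 hε).ne' ENNReal.ofReal_ne_top, mul_one] at h
    refine (measure_mono ?_).trans h
    rintro ω ⟨t, ht, hω⟩
    refine ⟨t, ht, ?_⟩
    rw [← ENNReal.ofReal_inv_of_pos hε]
    refine ENNReal.ofReal_le_ofReal ?_
    rw [I.selfNormExp_eq_exp hlam]
    have h1 : ∑ s ∈ Finset.range t, ξ s ω • x s ω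
        = R • ∑ s ∈ Finset.range t, (ξ s ω / R) • x s ω := by
      rw [Finset.smul_sum]
      refine Finset.sum_congr rfl fun s _ => ?_
      rw [smul_smul, mul_div_cancel₀ _ hR0.ne']
    rw [h1, wnorm_smul, abs_of_pos hR0, mul_lt_mul_iff_right₀ hR0] at hω
    have h2 := Real.lt_sq_of_sqrt_lt hω
    rw [← Real.exp_log (inv_pos.2 hε)]
    refine Real.exp_le_exp.2 ?_
    rw [one_div] at h2
    linarith

end SelfNormalized

/-! ### Sampling from a random policy, and Azuma-Hoeffding. -/

section ConditionalLaw

open scoped ENNReal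

theorem lintegral_prod_of_measure_inter {Ω Ω' E : Type*} [MeasurableSpace Ω] [MeasurableSpace Ω']
    [MeasurableSpace E] {P : Measure Ω} [IsProbabilityMeasure P] {φ : Ω → Ω'} (hφ : Measurable φ)
    {X : Ω → E} (hX : Measurable X) (κ : Kernel Ω' E) [IsMarkovKernel κ]
    (h : ∀ s, MeasurableSet s → ∀ B, MeasurableSet B →
      P (φ ⁻¹' s ∩ X ⁻¹' B) = ∫⁻ ω in φ ⁻¹' s, κ (φ ω) B ∂P)
    {F : Ω' × E → ℝ≥0∞} (hF : Measurable F) :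
    ∫⁻ ω, F (φ ω, X ω) ∂P = ∫⁻ ω, (∫⁻ x, F (φ ω, x) ∂(κ (φ ω))) ∂P := by
  have : IsProbabilityMeasure (P.map φ) := Measure.isProbabilityMeasure_map hφ.aemeasurable
  have : IsProbabilityMeasure (P.map fun ω => (φ ω, X ω)) :=
    Measure.isProbabilityMeasure_map (hφ.prodMk hX).aemeasurable
  have hmap : P.map (fun ω => (φ ω, X ω)) = (P.map φ) ⊗ₘ κ := by
    refine Measure.ext_prod fun {s B} hs hB => ?_
    rw [Measure.map_apply (hφ.prodMk hX) (hs.prod hB), Measure.compProd_apply_prod hs hB,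
      setLIntegral_map hs (κ.measurable_coe hB) hφ, ← h s hs B hB]
    rfl
  rw [← lintegral_map hF (hφ.prodMk hX), hmap, Measure.lintegral_compProd hF,
    lintegral_map hF.lintegral_kernel_prod_right' hφ]

variable {Ω : Type*} {m mΩ : MeasurableSpace Ω} {P : Measure Ω} [IsProbabilityMeasure P]
  {E : Type*} [MeasurableSpace E]

/-- The conditional law is given one Borel set at a time, with a null set depending on it; this
still fixes the joint law of (ω, X) on rectangles, hence on m ⊗ Borel. -/
theorem lintegral_condLaw (hm : m ≤ mΩ) {π : Ω → Measure E}
    (hπ : ∀ B, MeasurableSet B → Measurable[m] fun ω => π ω B)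
    (hprob : ∀ ω, IsProbabilityMeasure (π ω)) {X : Ω → E} (hX : Measurable X)
    (hlaw : ∀ B, MeasurableSet B →
      P[(X ⁻¹' B).indicator (fun _ => (1 : ℝ)) | m] =ᵐ[P] fun ω => (π ω).real B)
    {F : Ω × E → ℝ≥0∞} (hF : Measurable[m.prod inferInstance] F) :
    ∫⁻ ω, F (ω, X ω) ∂P = ∫⁻ ω, (∫⁻ x, F (ω, x) ∂(π ω)) ∂P := by
  let κ : @Kernel Ω E m _ := @Kernel.mk _ _ m _ π (Measure.measurable_of_measurable_coe _ hπ)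
  have hκ : @IsMarkovKernel _ _ m _ κ := @IsMarkovKernel.mk _ _ m _ κ hprob
  -- The conditioning variable is the identity from Ω to Ω with the coarser σ-algebra m.
  refine @lintegral_prod_of_measure_inter Ω Ω E mΩ m _ P _ id (measurable_id'' hm) X hX κ hκ ?_
    F hF
  intro s hs B hB
  have hs' := hm s hs
  have hXB := hX hB
  have hint : Integrable ((X ⁻¹' B).indicator fun _ => (1 : ℝ)) P :=
    (integrable_const _).indicator hXB
  have h1 := setIntegral_condExp hm hint hs
  rw [integral_indicator hXB, setIntegral_const, smul_eq_mul, mul_one,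
    setIntegral_congr_ae hs' ((hlaw B hB).mono fun ω h _ => h)] at h1
  have hreal : Measurable fun ω => (π ω).real B := ((hπ B hB).mono hm le_rfl).ennreal_toReal
  have h2 : ∫⁻ ω in s, π ω B ∂P = ENNReal.ofReal (∫ ω in s, (π ω).real B ∂P) := by
    rw [ofReal_integral_eq_lintegral_ofReal]
    · simp
    · refine Integrable.of_bound hreal.aestronglyMeasurable 1 (ae_of_all _ fun ω => ?_)
      rw [Real.norm_of_nonneg measureReal_nonneg]
      exact measureReal_le_one
    · exact ae_of_all _ fun ω => measureReal_nonneg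
  change P (s ∩ X ⁻¹' B) = ∫⁻ ω in s, π ω B ∂P
  rw [h2, h1, measureReal_def, Measure.restrict_apply hXB, Set.inter_comm,
    ENNReal.ofReal_toReal (measure_ne_top _ _)]

theorem measurable_integral_condLaw {π : Ω → Measure E}
    (hπ : ∀ B, MeasurableSet B → Measurable[m] fun ω => π ω B)
    (hprob : ∀ ω, IsProbabilityMeasure (π ω)) {g : Ω × E → ℝ}
    (hg : Measurable[m.prod inferInstance] g) :
    Measurable[m] fun ω => ∫ x, g (ω, x) ∂(π ω) := by
  let κ : @Kernel Ω E m _ := @Kernel.mk _ _ m _ π (Measure.measurable_of_measurable_coe _ hπ)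
  have hκ : @IsMarkovKernel _ _ m _ κ := @IsMarkovKernel.mk _ _ m _ κ hprob
  have hg' : StronglyMeasurable[m.prod inferInstance] g := Measurable.stronglyMeasurable hg
  have h := @StronglyMeasurable.integral_kernel_prod_right' Ω E m _ κ ℝ _ _ _ g
    hg'
  exact StronglyMeasurable.measurable h

theorem lintegral_exp_integral_sub_le {ρ : Measure E} [IsProbabilityMeasure ρ] {g : E → ℝ}
    (hg : Measurable g) {c : ℝ} (hc : ∀ᵐ x ∂ρ, g x ∈ Set.Icc 0 c) (a : ℝ) :
    ∫⁻ x, ENNReal.ofReal (Real.exp (a * ((∫ y, g y ∂ρ) - g x))) ∂ρ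
      ≤ ENNReal.ofReal (Real.exp (a ^ 2 * c ^ 2 / 8)) := by
  have h := hasSubgaussianMGF_of_mem_Icc hg.aemeasurable hc
  have he : ∀ x, Real.exp (a * ((∫ y, g y ∂ρ) - g x))
      = Real.exp (-a * (g x - ∫ y, g y ∂ρ)) := fun x => by ring_nf
  simp_rw [he]
  rw [← ofReal_integral_eq_lintegral_ofReal (h.integrable_exp_mul (-a))
    (ae_of_all _ fun x => (Real.exp_pos _).le)]
  refine ENNReal.ofReal_le_ofReal ((h.mgf_le (-a)).trans (le_of_eq ?_))
  congr 1
  simp only [sub_zero, NNReal.coe_pow, NNReal.coe_div, coe_nnnorm, NNReal.coe_ofNat, div_pow,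
    Real.norm_eq_abs, sq_abs]
  ring

/-- The Azuma-Hoeffding inequality for the deviations of `g_t(X_t)` below its conditional mean. -/
theorem measure_le_sum_integral_sub_le {𝓗 : Filtration ℕ mΩ} {T : ℕ} {π : ℕ → Ω → Measure E}
    (hπ : ∀ t < T, ∀ B, MeasurableSet B → Measurable[𝓗 t] fun ω => π t ω B)
    (hprob : ∀ t < T, ∀ ω, IsProbabilityMeasure (π t ω)) {X : ℕ → Ω → E}
    (hX : ∀ t < T, Measurable[𝓗 (t + 1)] (X t))
    (hlaw : ∀ t < T, ∀ B, MeasurableSet B →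
      P[(X t ⁻¹' B).indicator (fun _ => (1 : ℝ)) | 𝓗 t] =ᵐ[P] fun ω => (π t ω).real B)
    {g : ℕ → Ω × E → ℝ}
    (hg : ∀ t < T, Measurable[(𝓗 t : MeasurableSpace Ω).prod inferInstance] (g t))
    {c : ℝ} (hc : ∀ t < T, ∀ ω, ∀ᵐ x ∂(π t ω), g t (ω, x) ∈ Set.Icc 0 c)
    {a : ℝ} (ha : 0 ≤ a) (ε : ℝ) :
    P {ω | ε ≤ ∑ t ∈ Finset.range T, ((∫ x, g t (ω, x) ∂(π t ω)) - g t (ω, X t ω))}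
      ≤ ENNReal.ofReal (Real.exp (T * (a ^ 2 * c ^ 2 / 8) - a * ε)) := by
  set D : ℕ → Ω → ℝ := fun t ω => (∫ x, g t (ω, x) ∂(π t ω)) - g t (ω, X t ω) with hD
  have hDm : ∀ n ≤ T, ∀ t < n, Measurable[𝓗 n] (D t) := by
    intro n hn t ht
    have h1 := measurable_integral_condLaw (hπ t (by omega)) (hprob t (by omega)) (hg t (by omega))
    refine Measurable.sub (h1.mono (𝓗.mono ht.le) le_rfl) ?_
    have h2 : Measurable[𝓗 n, (𝓗 t : MeasurableSpace Ω).prod inferInstance] fun ω => (ω, X t ω) :=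
      @Measurable.prodMk _ (𝓗 n) _ _ (𝓗 t) _ _ _ (measurable_id'' (𝓗.mono ht.le))
        ((hX t (by omega)).mono (𝓗.mono ht) le_rfl)
    exact (hg t (by omega)).comp h2
  have hsum : ∀ n ≤ T, Measurable[𝓗 n] fun ω => ∑ t ∈ Finset.range n, D t ω := fun n hn =>
    Finset.measurable_sum _ fun t ht => hDm n hn t (Finset.mem_range.1 ht)
  have key : ∀ n ≤ T, ∫⁻ ω, ENNReal.ofReal (Real.exp (a * ∑ t ∈ Finset.range n, D t ω)) ∂P
      ≤ ENNReal.ofReal (Real.exp (n * (a ^ 2 * c ^ 2 / 8))) := by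
    intro n
    induction n with
    | zero => simp
    | succ n ih =>
      intro hn
      have hn' : n < T := hn
      have hS : Measurable[𝓗 n] fun ω =>
          ENNReal.ofReal (Real.exp (a * ∑ t ∈ Finset.range n, D t ω)) :=
        (Real.measurable_exp.comp ((hsum n hn'.le).const_mul a)).ennreal_ofReal
      have hI := measurable_integral_condLaw (hπ n hn') (hprob n hn') (hg n hn')
      have hF : Measurable[(𝓗 n : MeasurableSpace Ω).prod inferInstance] fun p : Ω × E =>
          ENNReal.ofReal (Real.exp (a * ∑ t ∈ Finset.range n, D t p.1))
            * ENNReal.ofReal (Real.exp (a * ((∫ x, g n (p.1, x) ∂(π n p.1)) - g n p))) := by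
        refine Measurable.mul (hS.comp (@measurable_fst _ _ (𝓗 n) _)) ?_
        refine (Real.measurable_exp.comp ?_).ennreal_ofReal
        exact ((hI.comp (@measurable_fst _ _ (𝓗 n) _)).sub (hg n hn')).const_mul a
      -- Averaging over X_n freezes the earlier deviations, leaving Hoeffding's lemma for the single
      -- law π_n(ω).
      have h1 := lintegral_condLaw (𝓗.le n) (hπ n hn') (hprob n hn')
        ((hX n hn').mono (𝓗.le _) le_rfl) (hlaw n hn') hF
      calc _ = ∫⁻ ω, ENNReal.ofReal (Real.exp (a * ∑ t ∈ Finset.range n, D t ω))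
              * ENNReal.ofReal (Real.exp (a * D n ω)) ∂P := by
            refine lintegral_congr fun ω => ?_
            rw [Finset.sum_range_succ, mul_add, Real.exp_add,
              ENNReal.ofReal_mul (Real.exp_pos _).le]
        _ = _ := h1
        _ ≤ ∫⁻ ω, ENNReal.ofReal (Real.exp (a * ∑ t ∈ Finset.range n, D t ω))
              * ENNReal.ofReal (Real.exp (a ^ 2 * c ^ 2 / 8)) ∂P := by
            refine lintegral_mono fun ω => ?_
            have := hprob n hn' ω
            dsimp only
            rw [lintegral_const_mul' _ _ ENNReal.ofReal_ne_top]
            gcongr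
            have hgω : Measurable fun x => g n (ω, x) :=
              (hg n hn').comp (@measurable_prodMk_left _ _ (𝓗 n) _ ω)
            exact lintegral_exp_integral_sub_le hgω (hc n hn' ω) a
        _ ≤ _ := by
            rw [lintegral_mul_const' _ _ ENNReal.ofReal_ne_top]
            refine (mul_le_mul_left (ih hn'.le) _).trans (le_of_eq ?_)
            rw [← ENNReal.ofReal_mul (Real.exp_pos _).le, ← Real.exp_add]
            congr 2
            push_cast
            ring
  have h1 := mul_meas_ge_le_lintegral (μ := P)
    ((Real.measurable_exp.comp (((hsum T le_rfl).mono (𝓗.le T) le_rfl).const_mul a)).ennreal_ofReal)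
    (ENNReal.ofReal (Real.exp (a * ε)))
  have h2 : P {ω | ε ≤ ∑ t ∈ Finset.range T, D t ω} ≤ P {ω | ENNReal.ofReal (Real.exp (a * ε))
      ≤ ENNReal.ofReal (Real.exp (a * ∑ t ∈ Finset.range T, D t ω))} := by
    refine measure_mono fun ω hω => ENNReal.ofReal_le_ofReal (Real.exp_le_exp.2 ?_)
    exact mul_le_mul_of_nonneg_left hω ha
  refine h2.trans ?_
  have h3 := h1.trans (key T le_rfl)
  have hpos : ENNReal.ofReal (Real.exp (a * ε)) ≠ 0 := (ENNReal.ofReal_pos.2 (Real.exp_pos _)).ne'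
  rw [mul_comm, ← ENNReal.le_div_iff_mul_le (Or.inl hpos) (Or.inl ENNReal.ofReal_ne_top),
    ← ENNReal.ofReal_div_of_pos (Real.exp_pos _), ← Real.exp_sub] at h3
  exact h3

end ConditionalLaw

/-! ### Policies through their mean action. -/

section Policies

variable {d : ℕ} {A : Set (Vec d)} {ρ : Measure (Vec d)} {L : ℝ}

theorem ae_mem_of_mem_policies (hρ : ρ ∈ policies A) : ∀ᵐ x ∂ρ, x ∈ A := hρ.2

theorem integrable_id_of_mem_policies (hρ : ρ ∈ policies A) (hA : ∀ x ∈ A, ‖x‖ ≤ L) :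
    Integrable (fun x : Vec d => x) ρ := by
  have := hρ.1
  refine Integrable.of_bound measurable_id.aestronglyMeasurable L ?_
  filter_upwards [ae_mem_of_mem_policies hρ] with x hx using hA x hx

theorem expValue_eq_inner (hρ : Integrable (fun x : Vec d => x) ρ) (v : Vec d) :
    expValue v ρ = inner ℝ (∫ x, x ∂ρ) v := by
  rw [expValue, real_inner_comm, ← integral_inner hρ v]
  exact integral_congr_ae (ae_of_all _ fun x => real_inner_comm _ _)

theorem inner_integral_projO (hρ : Integrable (fun x : Vec d => x) ρ) (x₀ : Vec d) :
    inner ℝ (∫ y, projO x₀ y ∂ρ) (unitDir x₀) = inner ℝ (∫ x, x ∂ρ) (unitDir x₀) := by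
  simp only [projO]
  rw [integral_smul_const]
  change inner ℝ (expValue (unitDir x₀) ρ • unitDir x₀) (unitDir x₀) = _
  rw [expValue_eq_inner hρ, inner_smul_left, conj_trivial, mul_comm, ← real_inner_smul_right,
    inner_unitDir_self_smul]

/-- The mixture of the policy `ρ` with the deterministic policy playing `x₀`. -/
noncomputable def mixPolicy (η : ℝ) (ρ : Measure (Vec d)) (x₀ : Vec d) : Measure (Vec d) :=
  ENNReal.ofReal η • ρ + ENNReal.ofReal (1 - η) • Measure.dirac x₀

theorem mixPolicy_mem_policies {η : ℝ} (h0 : 0 ≤ η) (h1 : η ≤ 1) (hρ : ρ ∈ policies A)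
    {x₀ : Vec d} (hx₀ : x₀ ∈ A) : mixPolicy η ρ x₀ ∈ policies A := by
  have := hρ.1
  refine ⟨⟨?_⟩, ?_⟩
  · simp [mixPolicy, ← ENNReal.ofReal_add h0 (sub_nonneg.2 h1)]
  · simp [mixPolicy, hρ.2, hx₀]

theorem integral_id_mixPolicy {η : ℝ} (h0 : 0 ≤ η) (h1 : η ≤ 1)
    (hρ : Integrable (fun x : Vec d => x) ρ) (x₀ : Vec d) :
    ∫ x, x ∂(mixPolicy η ρ x₀) = η • (∫ x, x ∂ρ) + (1 - η) • x₀ := by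
  rw [mixPolicy, integral_add_measure (hρ.smul_measure ENNReal.ofReal_ne_top)
    ((integrable_dirac (by simp)).smul_measure ENNReal.ofReal_ne_top),
    integral_smul_measure, integral_smul_measure, integral_dirac, ENNReal.toReal_ofReal h0,
    ENNReal.toReal_ofReal (sub_nonneg.2 h1)]

end Policies

/-! ### One round on the good event. -/

section Round

variable {d : ℕ} {I : Input d}

theorem Input.beta_nonneg (hR : 0 ≤ I.R) (hS : 0 < I.S) (t k : ℕ) : 0 ≤ I.beta t k := by
  rw [Input.beta]; positivity

theorem Input.beta_le_beta (hR : 0 ≤ I.R) (hlam : 0 < I.lam) (hδ0 : 0 < I.δ) (hδ1 : I.δ < 1)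
    {t T k l : ℕ} (ht : 1 ≤ t) (htT : t ≤ T) (hkl : k ≤ l) : I.beta t k ≤ I.beta T l := by
  have h1 : (0 : ℝ) ≤ (t : ℝ) - 1 := by
    have : (1 : ℝ) ≤ t := by exact_mod_cast ht
    linarith
  have h2 : (t : ℝ) - 1 ≤ T - 1 := by
    have : (t : ℝ) ≤ T := by exact_mod_cast htT
    linarith
  have h3 : 1 ≤ (1 + ((t : ℝ) - 1) * I.L ^ 2 / I.lam) / I.δ := by
    rw [le_div_iff₀ hδ0]
    have : 0 ≤ ((t : ℝ) - 1) * I.L ^ 2 / I.lam := by positivity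
    linarith
  have h4 := Real.log_nonneg h3
  have h5 : (1 + ((t : ℝ) - 1) * I.L ^ 2 / I.lam) / I.δ
      ≤ (1 + ((T : ℝ) - 1) * I.L ^ 2 / I.lam) / I.δ := by gcongr
  have h6 := Real.log_le_log (by linarith) h5
  have h7 : (k : ℝ) ≤ l := by exact_mod_cast hkl
  rw [Input.beta, Input.beta]
  gcongr

variable {x : ℕ → Vec d} {r c : ℕ → ℝ} {t : ℕ} {A : Set (Vec d)} {ρ : Measure (Vec d)}
  {θs μs : Vec d}

/-- Two points of the ellipsoid are at most a diameter apart, and their difference is orthogonal to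
x₀, so only the projection of v matters. -/
theorem Input.inner_sub_le_of_mem_costSet (hlam : 0 < I.lam) {μ μ' : Vec d}
    (hμ : μ ∈ I.costSet x c t) (hμ' : μ' ∈ I.costSet x c t) (v : Vec d) :
    inner ℝ v μ ≤ inner ℝ v μ'
      + 2 * (I.αc * I.beta (t + 1) (Module.finrank ℝ (perpSpace I.x₀)))
        * wnorm (I.gramProj x t)⁻¹ (projPerp I.x₀ v) := by
  have hV := I.gramProj_posDef hlam x t
  have hhat := I.muHat_mem hlam x c t
  have h1 := hμ.2
  have h2 := hμ'.2
  rw [I.wnorm_gramPerp x t (Submodule.sub_mem _ hμ.1 hhat)] at h1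
  rw [I.wnorm_gramPerp x t (Submodule.sub_mem _ hμ'.1 hhat)] at h2
  have h3 := wnorm_sub_le hV μ (I.muHat x c t) μ'
  have h4 := inner_le_wnorm_mul_wnorm hV (projPerp I.x₀ v) (μ - μ')
  rw [inner_projPerp_left (Submodule.sub_mem _ hμ.1 hμ'.1), inner_sub_right] at h4
  have h5 := wnorm_nonneg (I.gramProj x t)⁻¹ (projPerp I.x₀ v)
  nlinarith

theorem Input.pessCost_eq (hρ : Integrable (fun x : Vec d => x) ρ) :
    I.pessCost x c t ρ = inner ℝ (∫ x, x ∂ρ) (unitDir I.x₀) * I.c₀ / ‖I.x₀‖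
      + sSup ((fun μ => inner ℝ (∫ x, x ∂ρ) μ) '' I.costSet x c t) := by
  rw [Input.pessCost, inner_integral_projO hρ]
  simp only [expValue_eq_inner hρ]

theorem Input.inner_eq_add_inner_projPerp (hc₀ : inner ℝ I.x₀ μs = I.c₀) (v : Vec d) :
    inner ℝ v μs = inner ℝ v (unitDir I.x₀) * I.c₀ / ‖I.x₀‖
      + inner ℝ v (projPerp I.x₀ μs) := by
  rw [projPerp_eq, inner_sub_right, inner_smul_right, real_inner_comm (unitDir I.x₀) μs,
    inner_unitDir_eq, hc₀]
  ring

theorem Input.expValue_le_pessCost (hlam : 0 < I.lam) (hc₀ : inner ℝ I.x₀ μs = I.c₀)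
    (hμ : projPerp I.x₀ μs ∈ I.costSet x c t) (hρ : Integrable (fun x : Vec d => x) ρ) :
    expValue μs ρ ≤ I.pessCost x c t ρ := by
  rw [I.pessCost_eq hρ, expValue_eq_inner hρ, I.inner_eq_add_inner_projPerp hc₀]
  -- Without boundedness `sSup` would be the default 0 and bound nothing.
  have hbdd : BddAbove ((fun μ => inner ℝ (∫ x, x ∂ρ) μ) '' I.costSet x c t) := by
    refine ⟨inner ℝ (∫ x, x ∂ρ) (projPerp I.x₀ μs)
      + 2 * (I.αc * I.beta (t + 1) (Module.finrank ℝ (perpSpace I.x₀)))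
        * wnorm (I.gramProj x t)⁻¹ (projPerp I.x₀ (∫ x, x ∂ρ)), ?_⟩
    rintro _ ⟨μ, hμ', rfl⟩
    exact I.inner_sub_le_of_mem_costSet hlam hμ' hμ _
  gcongr
  exact le_csSup hbdd ⟨_, hμ, rfl⟩

/-- Optimism: some estimated feasible policy and some parameter in the confidence set are
together at least as good as any feasible policy under the true parameter. -/
theorem Input.exists_le_expValue (hR : 0 ≤ I.R) (hS : 0 < I.S) (hlam : 0 < I.lam)
    (hδ0 : 0 < I.δ) (hδ1 : I.δ < 1)
    (hAL : ∀ x ∈ A, ‖x‖ ≤ I.L) (hAr : ∀ x ∈ A, inner ℝ x θs ∈ Set.Icc (0 : ℝ) 1)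
    (hx₀ : I.x₀ ∈ A) (hr₀ : inner ℝ I.x₀ θs = I.r₀) (hc₀ : inner ℝ I.x₀ μs = I.c₀)
    (hτ : I.c₀ < I.τ) (hαc : I.αc = 1) (hαr : I.αr = 1 + 2 * (1 - I.r₀) / (I.τ - I.c₀))
    (hθ : wnorm (I.gram x t) (θs - I.thetaHat x r t) ≤ I.beta (t + 1) d)
    (hμ : projPerp I.x₀ μs ∈ I.costSet x c t) (hρ : ρ ∈ feasiblePolicies μs I.τ A) :
    ∃ ρ' ∈ I.safePolicies x c t A, ∃ θ ∈ I.rewardSet x r t, expValue θs ρ ≤ expValue θ ρ' := by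
  have hint := integrable_id_of_mem_policies hρ.1 hAL
  have hV := I.gram_posDef hlam x t
  set k := Module.finrank ℝ (perpSpace I.x₀) with hk
  have hkd : k ≤ d := by
    have := Submodule.finrank_le (perpSpace I.x₀)
    rwa [finrank_euclideanSpace_fin] at this
  set B := I.beta (t + 1) d with hB
  set b := I.beta (t + 1) k with hb
  have hb0 : 0 ≤ b := I.beta_nonneg hR hS _ _
  have hB0 : 0 ≤ B := I.beta_nonneg hR hS _ _
  have hbB : b ≤ B := I.beta_le_beta hR hlam hδ0 hδ1 (by omega) le_rfl hkd
  set v := ∫ x, x ∂ρ with hv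
  set N := wnorm (I.gramProj x t)⁻¹ (projPerp I.x₀ v) with hN
  have hN0 : 0 ≤ N := wnorm_nonneg _ _
  have hgap : 0 < I.τ - I.c₀ := sub_pos.2 hτ
  have hden : 0 < I.τ - I.c₀ + 2 * b * N := by positivity
  -- The mixture costs at most ητ + (1 − η)c₀, plus 2bηN for pessimism; this η makes the total
  -- exactly τ.
  set η := (I.τ - I.c₀) / (I.τ - I.c₀ + 2 * b * N) with hη
  have hη0 : 0 ≤ η := by positivity
  have hη1 : η ≤ 1 := by
    rw [hη, div_le_one hden]
    have : 0 ≤ 2 * b * N := by positivity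
    linarith
  have hηeq : η * (I.τ - I.c₀ + 2 * b * N) = I.τ - I.c₀ := div_mul_cancel₀ _ hden.ne'
  have hmem := mixPolicy_mem_policies hη0 hη1 hρ.1 hx₀
  have hint' := integrable_id_of_mem_policies hmem hAL
  have hmean := integral_id_mixPolicy hη0 hη1 hint I.x₀
  rw [← hv] at hmean
  set v' := ∫ x, x ∂(mixPolicy η ρ I.x₀) with hv'
  have hproj : projPerp I.x₀ v' = η • projPerp I.x₀ v := by
    rw [hmean, projPerp_add, projPerp_smul, projPerp_smul, projPerp_self, smul_zero, add_zero]
  have hN' : wnorm (I.gramProj x t)⁻¹ (projPerp I.x₀ v') = η * N := by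
    rw [hproj, wnorm_smul, abs_of_nonneg hη0]
  have hinner : ∀ w : Vec d, inner ℝ v' w = η * inner ℝ v w + (1 - η) * inner ℝ I.x₀ w := by
    intro w
    rw [hmean, inner_add_left, inner_smul_left, inner_smul_left]
    simp
  have hsafe : mixPolicy η ρ I.x₀ ∈ I.safePolicies x c t A := by
    refine ⟨hmem, ?_⟩
    rw [I.pessCost_eq hint', ← hv']
    have h1 : sSup ((fun μ => inner ℝ v' μ) '' I.costSet x c t)
        ≤ inner ℝ v' (projPerp I.x₀ μs) + 2 * (I.αc * b) * (η * N) := by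
      refine csSup_le ⟨_, _, hμ, rfl⟩ ?_
      rintro _ ⟨μ, hμ', rfl⟩
      rw [← hN']
      exact I.inner_sub_le_of_mem_costSet hlam hμ' hμ _
    have h2 := I.inner_eq_add_inner_projPerp hc₀ v'
    have h3 := hinner μs
    have h4 := hρ.2
    rw [expValue_eq_inner hint, ← hv] at h4
    rw [hc₀] at h3
    rw [hαc] at h1
    have h5 := mul_le_mul_of_nonneg_left h4 hη0
    linarith
  set W := wnorm (I.gram x t)⁻¹ v' with hW
  have hW0 : 0 ≤ W := wnorm_nonneg _ _
  have hNW : η * N ≤ W := by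
    rw [← hN']; exact I.wnorm_inv_gramProj_projPerp_le hlam x t v'
  have hr1 : I.r₀ ≤ 1 := hr₀ ▸ (hAr _ hx₀).2
  have hα : 0 ≤ I.αr - 1 := by
    rw [hαr, add_sub_cancel_left]
    exact div_nonneg (by linarith) hgap.le
  -- Moving θ_* along Σ⁻¹v' by this amount uses up the radius (α_r − 1)B and gains (α_r − 1)BW in
  -- value. If W = 0, division gives s = 0, and nothing has to be gained since ηN ≤ W.
  set s := (I.αr - 1) * B / W with hs
  have hs0 : 0 ≤ s := by positivity
  have hsW : s * W ≤ (I.αr - 1) * B := by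
    rcases hW0.eq_or_lt with h | h
    · rw [← h, mul_zero]; positivity
    · rw [hs, div_mul_cancel₀ _ h.ne']
  have hsW2 : s * W ^ 2 = (I.αr - 1) * B * W := by
    by_cases h : W = 0
    · simp [h]
    · rw [hs]; field_simp
  refine ⟨_, hsafe, θs + s • mulv (I.gram x t)⁻¹ v', ?_, ?_⟩
  · change wnorm _ _ ≤ I.αr * B
    rw [add_sub_right_comm]
    refine (wnorm_add_le hV _ _).trans ?_
    rw [wnorm_smul, wnorm_mulv_inv hV, abs_of_nonneg hs0]
    linarith
  · rw [expValue_eq_inner hint', ← hv', inner_add_right, inner_smul_right, ← wnorm_sq hV.inv,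
      ← hW, hsW2, hinner, hr₀, ← expValue_eq_inner hint]
    have hρ1 : expValue θs ρ ≤ 1 := by
      have := hρ.1.1
      calc expValue θs ρ ≤ ∫ _x, (1 : ℝ) ∂ρ := by
            refine integral_mono_ae (hint.inner_const θs) (integrable_const _) ?_
            filter_upwards [ae_mem_of_mem_policies hρ.1] with y hy using (hAr y hy).2
        _ = 1 := by simp
    have h1 : (1 - η) * (expValue θs ρ - I.r₀) ≤ (1 - η) * (1 - I.r₀) := by
      have := sub_nonneg.2 hη1
      gcongr
    -- This identity dictates α_r: 1 − η = 2bηN/(τ − c₀).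
    have h2 : (1 - η) * (1 - I.r₀) = (I.αr - 1) * (b * (η * N)) := by
      rw [hαr, add_sub_cancel_left, div_mul_eq_mul_div, eq_div_iff hgap.ne']
      linear_combination (1 - I.r₀) * (-hηeq)
    have h3 : (I.αr - 1) * (b * (η * N)) ≤ (I.αr - 1) * (B * W) := by gcongr
    linarith

theorem integrable_wnorm (V : Matrix (Fin d) (Fin d) ℝ) {L : ℝ} (hρ : ρ ∈ policies A)
    (hV : ∀ x ∈ A, wnorm V x ≤ L) : Integrable (fun x => wnorm V x) ρ := by
  have := hρ.1
  refine Integrable.of_bound (measurable_wnorm (A := fun _ => V)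
    (fun _ _ => measurable_const) measurable_id).aestronglyMeasurable L ?_
  filter_upwards [ae_mem_of_mem_policies hρ] with y hy
  rw [Real.norm_of_nonneg (wnorm_nonneg _ _)]
  exact hV y hy

/-- The instantaneous regret is at most a multiple of the expected confidence width. -/
theorem Input.expValue_sub_le (hR : 0 ≤ I.R) (hS : 0 < I.S) (hlam : 0 < I.lam)
    (hδ0 : 0 < I.δ) (hδ1 : I.δ < 1)
    (hAL : ∀ x ∈ A, ‖x‖ ≤ I.L) (hAr : ∀ x ∈ A, inner ℝ x θs ∈ Set.Icc (0 : ℝ) 1)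
    (hx₀ : I.x₀ ∈ A) (hr₀ : inner ℝ I.x₀ θs = I.r₀) (hc₀ : inner ℝ I.x₀ μs = I.c₀)
    (hτ : I.c₀ < I.τ) (hαc : I.αc = 1) (hαr : I.αr = 1 + 2 * (1 - I.r₀) / (I.τ - I.c₀))
    (hθ : wnorm (I.gram x t) (θs - I.thetaHat x r t) ≤ I.beta (t + 1) d)
    (hμ : projPerp I.x₀ μs ∈ I.costSet x c t) {ρs : Measure (Vec d)}
    (hρs : ρs ∈ feasiblePolicies μs I.τ A) (hρ : I.IsChoice x r c t A ρ) :
    expValue θs ρs - expValue θs ρ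
      ≤ (I.αr + 1) * I.beta (t + 1) d * ∫ y, wnorm (I.gram x t)⁻¹ y ∂ρ := by
  obtain ⟨ρ', hρ', θ, hθ', hle⟩ := I.exists_le_expValue hR hS hlam hδ0 hδ1 hAL hAr hx₀ hr₀ hc₀ hτ
    hαc hαr hθ hμ hρs
  obtain ⟨hsafe, θt, hθt, hmax⟩ := hρ
  have h1 := hle.trans (hmax ρ' hρ' θ hθ')
  have hint := integrable_id_of_mem_policies hsafe.1 hAL
  have hV := I.gram_posDef hlam x t
  have hw : wnorm (I.gram x t) (θt - θs) ≤ (I.αr + 1) * I.beta (t + 1) d := by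
    have h2 := wnorm_sub_le hV θt (I.thetaHat x r t) θs
    have h3 : wnorm (I.gram x t) (θt - I.thetaHat x r t) ≤ I.αr * I.beta (t + 1) d := hθt
    linarith
  have hiw := integrable_wnorm (ρ := ρ) (A := A) (L := I.L / Real.sqrt I.lam) (I.gram x t)⁻¹
    hsafe.1 fun y hy => (I.wnorm_inv_gram_le hlam x t y).trans (by gcongr; exact hAL y hy)
  calc expValue θs ρs - expValue θs ρ ≤ expValue θt ρ - expValue θs ρ := by linarith
    _ = ∫ y, inner ℝ y (θt - θs) ∂ρ := by
        rw [expValue_eq_inner hint, expValue_eq_inner hint, ← inner_sub_right,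
          ← expValue_eq_inner hint, expValue]
    _ ≤ ∫ y, (I.αr + 1) * I.beta (t + 1) d * wnorm (I.gram x t)⁻¹ y ∂ρ := by
        refine integral_mono (hint.inner_const _) (hiw.const_mul _) fun y => ?_
        refine (inner_le_wnorm_mul_wnorm hV y _).trans ?_
        rw [mul_comm]
        exact mul_le_mul_of_nonneg_right hw (wnorm_nonneg _ _)
    _ = _ := integral_const_mul _ _

end Round

/-! ### Probability of the good events. -/

section Events

variable {d : ℕ} {I : Input d}

/-- The radius puts the factor k on log(1/δ) as well as on the log-determinant, so it affords the
failure probability δ^(k/2). -/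
theorem Input.sqrt_log_add_le (hlam : 0 < I.lam) (hδ0 : 0 < I.δ) {t k : ℕ} {D : ℝ} (hD : 0 < D)
    (hDk : D ≤ (1 + t * I.L ^ 2 / I.lam) ^ k) :
    Real.sqrt (Real.log D + 2 * Real.log (1 / I.δ ^ ((k : ℝ) / 2)))
      ≤ Real.sqrt (k * Real.log ((1 + (((t + 1 : ℕ) : ℝ) - 1) * I.L ^ 2 / I.lam) / I.δ)) := by
  refine Real.sqrt_le_sqrt ?_
  have h1 := Real.log_le_log hD hDk
  rw [Real.log_pow] at h1
  have h2 : (0 : ℝ) < 1 + t * I.L ^ 2 / I.lam := by positivity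
  rw [Nat.cast_succ, add_sub_cancel_right, Real.log_div h2.ne' hδ0.ne', one_div, Real.log_inv,
    Real.log_rpow hδ0]
  linarith

theorem Input.wnorm_sub_thetaHat_le {x : ℕ → Vec d} {ξ : ℕ → ℝ} {t : ℕ} {θs : Vec d}
    (hR : 0 ≤ I.R) (hlam : 0 < I.lam) (hδ0 : 0 < I.δ) (hθS : ‖θs‖ ≤ I.S)
    (hx : ∀ s < t, ‖x s‖ ≤ I.L)
    (h : wnorm (I.gram x t)⁻¹ (∑ s ∈ Finset.range t, ξ s • x s)
      ≤ I.R * Real.sqrt (Real.log ((I.gram x t).det / I.lam ^ d)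
        + 2 * Real.log (1 / I.δ ^ ((d : ℝ) / 2)))) :
    wnorm (I.gram x t) (θs - I.thetaHat x (fun s => inner ℝ (x s) θs + ξ s) t)
      ≤ I.beta (t + 1) d := by
  refine (I.wnorm_sub_leastSquares_le hlam x ξ t θs).trans ?_
  have hdet := (I.gram_posDef hlam x t).det_pos
  have h1 := I.sqrt_log_add_le hlam hδ0 (by positivity) (I.det_gram_le hlam hx)
  exact add_le_add (h.trans (by gcongr)) (by gcongr)

theorem Input.projPerp_mem_costSet {x : ℕ → Vec d} {ξ : ℕ → ℝ} {t : ℕ} {μs : Vec d}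
    (hR : 0 ≤ I.R) (hlam : 0 < I.lam) (hδ0 : 0 < I.δ) (hμS : ‖μs‖ ≤ I.S)
    (hc₀ : inner ℝ I.x₀ μs = I.c₀) (hαc : I.αc = 1) (hx : ∀ s < t, ‖x s‖ ≤ I.L)
    (h : wnorm (I.gramProj x t)⁻¹ (∑ s ∈ Finset.range t, ξ s • projPerp I.x₀ (x s))
      ≤ I.R * Real.sqrt (Real.log ((I.gramProj x t).det / I.lam ^ d)
        + 2 * Real.log (1 / I.δ ^ ((Module.finrank ℝ (perpSpace I.x₀) : ℝ) / 2)))) :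
    projPerp I.x₀ μs ∈ I.costSet x (fun s => inner ℝ (x s) μs + ξ s) t := by
  refine ⟨projPerp_mem _ _, ?_⟩
  rw [I.wnorm_gramPerp x t (Submodule.sub_mem _ (projPerp_mem _ _) (I.muHat_mem hlam _ _ _)),
    I.muHat_eq hlam, hαc, one_mul]
  simp only [I.costPerp_signal hc₀]
  refine (I.wnorm_sub_leastSquares_le hlam (fun s => projPerp I.x₀ (x s)) ξ t _).trans ?_
  have hdet := (I.gramProj_posDef hlam x t).det_pos
  have h1 := I.sqrt_log_add_le hlam hδ0 (by positivity) (I.det_gramProj_le hlam hx)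
  exact add_le_add (h.trans (by gcongr))
    (by gcongr; exact (norm_projPerp_le _ _).trans hμS)

variable {Ω : Type*} [mΩ : MeasurableSpace Ω] {P : Measure Ω} [IsProbabilityMeasure P]
  {T : ℕ} {A : ℕ → Ω → Set (Vec d)} {𝓗 : Filtration ℕ mΩ} {π : ℕ → Ω → Measure (Vec d)}
  {X : ℕ → Ω → Vec d} {ξr ξc : ℕ → Ω → ℝ} {R L : ℝ}

/-- The action sets need not be measurable, so the conditional law is applied to the Borel set ‖x‖ >
L instead. -/
theorem measure_exists_lt_norm_eq_zero (hrun : IsInteraction P R T 𝓗 π X ξr ξc)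
    (hpol : ∀ t < T, ∀ ω, π t ω ∈ policies (A t ω))
    (hAL : ∀ t < T, ∀ ω, ∀ x ∈ A t ω, ‖x‖ ≤ L) :
    P {ω | ∃ t < T, L < ‖X t ω‖} = 0 := by
  have h : {ω | ∃ t < T, L < ‖X t ω‖} = ⋃ t ∈ Set.Iio T, {ω | L < ‖X t ω‖} := by
    ext ω; simp
  rw [h, measure_biUnion_null_iff (Set.to_countable _)]
  intro t ht'
  have hB : MeasurableSet {x : Vec d | L < ‖x‖} := measurableSet_lt measurable_const measurable_norm
  have hX : Measurable (X t) := (hrun.action_measurable t ht').mono (𝓗.le _) le_rfl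
  have h0 : ∀ ω, (π t ω).real {x : Vec d | L < ‖x‖} = 0 := by
    intro ω
    rw [measureReal_def, measure_mono_null _ (hpol t ht' ω).2, ENNReal.toReal_zero]
    exact fun x hx hxA => absurd (hAL t ht' ω x hxA) (not_le.2 hx)
  have h1 := integral_condExp (μ := P) (𝓗.le t)
    (f := (X t ⁻¹' {x : Vec d | L < ‖x‖}).indicator fun _ => (1 : ℝ))
  rw [integral_congr_ae (hrun.action_law t ht' _ hB), integral_indicator (hX hB),
    setIntegral_const, smul_eq_mul, mul_one] at h1
  simp only [h0, integral_zero] at h1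
  exact (measureReal_eq_zero_iff (measure_ne_top _ _)).1 h1.symm

theorem measure_widthDeviation_le (hlam : 0 < I.lam) (hL : 0 < I.L) (hδ0 : 0 < I.δ)
    (hδ1 : I.δ < 1) (hT : 0 < T) (hrun : IsInteraction P R T 𝓗 π X ξr ξc)
    (hpol : ∀ t < T, ∀ ω, π t ω ∈ policies (A t ω))
    (hAL : ∀ t < T, ∀ ω, ∀ x ∈ A t ω, ‖x‖ ≤ I.L) :
    P {ω | 2 * (I.L / Real.sqrt I.lam) * Real.sqrt (2 * T * Real.log (1 / I.δ))
        ≤ ∑ t ∈ Finset.range T, ((∫ y, wnorm (I.gram (fun s => X s ω) t)⁻¹ y ∂(π t ω))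
          - wnorm (I.gram (fun s => X s ω) t)⁻¹ (X t ω))}
      ≤ ENNReal.ofReal (I.δ ^ 3) := by
  set c := I.L / Real.sqrt I.lam with hc
  have hc0 : 0 < c := div_pos hL (Real.sqrt_pos.2 hlam)
  set l := Real.log (1 / I.δ) with hl
  have hl0 : 0 < l := Real.log_pos (one_lt_one_div hδ0 hδ1)
  have hT' : (0 : ℝ) < T := by exact_mod_cast hT
  have h := measure_le_sum_integral_sub_le (P := P) (𝓗 := 𝓗) (T := T) (π := π) (X := X)
    (g := fun t p => wnorm (I.gram (fun s => X s p.1) t)⁻¹ p.2)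
    hrun.policy_measurable (fun t ht ω => (hpol t ht ω).1) hrun.action_measurable
    -- With l = log(1/δ), the Chernoff exponent is l/4 − 4l ≤ −3l. This a is not optimal, but δ³
    -- suffices.
    hrun.action_law (c := c) (a := Real.sqrt (2 * l / T) / c) ?_ ?_ (by positivity)
    (2 * c * Real.sqrt (2 * T * l))
  · refine h.trans (ENNReal.ofReal_le_ofReal ?_)
    have h1 : Real.sqrt (2 * l / T) * Real.sqrt (2 * T * l) = 2 * l := by
      rw [← Real.sqrt_mul (by positivity), show 2 * l / T * (2 * T * l) = (2 * l) ^ 2 by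
        field_simp, Real.sqrt_sq (by positivity)]
    have h2 : T * ((Real.sqrt (2 * l / T) / c) ^ 2 * c ^ 2 / 8) = l / 4 := by
      rw [div_pow, Real.sq_sqrt (by positivity)]
      field_simp
      norm_num
    have h3 : Real.sqrt (2 * l / T) / c * (2 * c * Real.sqrt (2 * T * l)) = 4 * l := by
      calc _ = 2 * (Real.sqrt (2 * l / T) * Real.sqrt (2 * T * l)) := by field_simp
        _ = 4 * l := by rw [h1]; ring
    rw [h2, h3, ← Real.exp_log (pow_pos hδ0 3), Real.log_pow]
    refine Real.exp_le_exp.2 ?_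
    rw [hl, one_div, Real.log_inv] at hl0 ⊢
    push_cast
    linarith
  · intro t ht
    have hx : ∀ s < t, Measurable[(𝓗 t : MeasurableSpace Ω).prod inferInstance]
        fun p : Ω × Vec d => X s p.1 := fun s hs =>
      ((hrun.action_measurable s (hs.trans ht)).mono (𝓗.mono hs) le_rfl).comp
        (@measurable_fst _ _ (𝓗 t) _)
    exact measurable_wnorm (measurable_inv_apply (I.measurable_gram_apply hx))
      (@measurable_snd _ _ (𝓗 t) _)
  · intro t ht ω
    filter_upwards [ae_mem_of_mem_policies (hpol t ht ω)] with y hy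
    refine ⟨wnorm_nonneg _ _, (I.wnorm_inv_gram_le hlam _ t y).trans ?_⟩
    rw [hc]
    gcongr
    exact hAL t ht ω y hy

end Events

end OPLB

/-! ### Assembly of the regret bound. -/

theorem mainTheorem2
    {d : ℕ} (hd : 3 ≤ d)
    {Ω : Type*} [mΩ : MeasurableSpace Ω] (P : Measure Ω) [IsProbabilityMeasure P]
    -- the inputs of the algorithm, the unknown parameters, and the (possibly random) action sets
    (I : OPLB.Input d) (θs μs : OPLB.Vec d) (T : ℕ) (A : ℕ → Ω → Set (OPLB.Vec d))
    (hR : 0 ≤ I.R) (hS : 0 < I.S) (hL : 0 < I.L) (hlam : I.L ^ 2 ≤ I.lam)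
    (hδ0 : 0 < I.δ) (hδ1 : I.δ < 1)
    -- bounded parameters, bounded actions, bounded mean rewards and costs
    (hθS : ‖θs‖ ≤ I.S) (hμS : ‖μs‖ ≤ I.S)
    (hAL : ∀ t < T, ∀ ω, ∀ x ∈ A t ω, ‖x‖ ≤ I.L)
    (hAr : ∀ t < T, ∀ ω, ∀ x ∈ A t ω, inner ℝ x θs ∈ Set.Icc (0 : ℝ) 1)
    (hAc : ∀ t < T, ∀ ω, ∀ x ∈ A t ω, inner ℝ x μs ∈ Set.Icc (0 : ℝ) 1)
    -- safe action with known reward and cost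
    (hx₀ : ∀ t < T, ∀ ω, I.x₀ ∈ A t ω)
    (hr₀ : inner ℝ I.x₀ θs = I.r₀) (hc₀ : inner ℝ I.x₀ μs = I.c₀) (hτ : I.c₀ < I.τ)
    -- the scaling parameters
    (hαc : I.αc = 1) (hαr : I.αr = 1 + 2 * (1 - I.r₀) / (I.τ - I.c₀))
    -- the interaction, with policies chosen by the algorithm
    (𝓗 : Filtration ℕ mΩ) (π : ℕ → Ω → Measure (OPLB.Vec d)) (X : ℕ → Ω → OPLB.Vec d)
    (ξr ξc : ℕ → Ω → ℝ)
    (hrun : OPLB.IsInteraction P I.R T 𝓗 π X ξr ξc)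
    (halg : ∀ t < T, ∀ ω, I.IsChoice (fun s => X s ω) (OPLB.signal θs X ξr ω)
      (OPLB.signal μs X ξc ω) t (A t ω) (π t ω))
    -- the optimal feasible policies
    (πstar : ℕ → Ω → Measure (OPLB.Vec d))
    (hstar : ∀ t < T, ∀ ω, OPLB.IsOptimalFeasible θs μs I.τ (A t ω) (πstar t ω)) :
    P {ω | ¬ ((∀ t < T, π t ω ∈ OPLB.feasiblePolicies μs I.τ (A t ω)) ∧
        OPLB.regret θs T πstar π ω ≤
          2 * I.L * (I.αr + 1) * I.beta T d / Real.sqrt I.lam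
              * Real.sqrt (2 * T * Real.log (1 / I.δ))
            + (I.αr + 1) * I.beta T d
              * Real.sqrt (2 * T * d * Real.log (1 + T * I.L ^ 2 / I.lam)))}
      ≤ ENNReal.ofReal (2 * I.δ) := by
  -- For δ ≥ 1/2 the claim is empty; the final union bound needs δ < 1/2.
  rcases le_or_gt (1 / 2) I.δ with hδ | hδ
  · exact prob_le_one.trans (ENNReal.one_le_ofReal.2 (by linarith))
  rcases T.eq_zero_or_pos with hT | hT
  · subst hT
    refine le_of_eq_of_le (measure_mono_null (fun ω hω => hω ⟨by simp, ?_⟩) measure_empty) zero_le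
    simp [OPLB.regret]
  have hlam0 : 0 < I.lam := lt_of_lt_of_le (by positivity) hlam
  have hpol : ∀ t < T, ∀ ω, π t ω ∈ OPLB.policies (A t ω) := fun t ht ω => (halg t ht ω).1.1
  set k := Module.finrank ℝ (OPLB.perpSpace I.x₀) with hk
  have hk2 : 2 ≤ k := by
    by_cases h0 : I.x₀ = 0
    · rw [hk, h0, OPLB.finrank_perpSpace_zero]; omega
    · have := OPLB.finrank_perpSpace h0
      omega
  set 𝓖 : ℕ → MeasurableSpace Ω := fun t => 𝓗 t ⊔ MeasurableSpace.comap (X t) inferInstance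
    with h𝓖
  have hX : ∀ t < T, Measurable (X t) := fun t ht =>
    (hrun.action_measurable t ht).mono (𝓗.le _) le_rfl
  have h𝓖1 : ∀ t < T, 𝓗 t ≤ 𝓖 t := fun t _ => le_sup_left
  have h𝓖2 : ∀ t < T, 𝓖 t ≤ mΩ := fun t ht => sup_le (𝓗.le t) (hX t ht).comap_le
  have hX𝓖 : ∀ t < T, Measurable[𝓖 t] (X t) := fun t _ =>
    (comap_measurable (X t)).mono le_sup_right le_rfl
  have hP := OPLB.measurable_projPerp I.x₀
  have h1 := I.measure_exists_lt_wnorm_le (P := P) hlam0 hR h𝓖1 h𝓖2 hrun.action_measurable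
    hrun.noise_reward_measurable hX𝓖 hrun.noise_reward
    (Real.rpow_pos_of_pos hδ0 ((d : ℝ) / 2))
  have h2 := I.measure_exists_lt_wnorm_le (P := P) (x := fun t ω => OPLB.projPerp I.x₀ (X t ω))
    hlam0 hR h𝓖1 h𝓖2 (fun t ht => hP.comp (hrun.action_measurable t ht))
    hrun.noise_cost_measurable (fun t ht => hP.comp (hX𝓖 t ht)) hrun.noise_cost
    (Real.rpow_pos_of_pos hδ0 ((k : ℝ) / 2))
  have h3 := OPLB.measure_widthDeviation_le hlam0 hL hδ0 hδ1 hT hrun hpol hAL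
  have h4 := OPLB.measure_exists_lt_norm_eq_zero hrun hpol hAL
  refine (measure_mono ?_).trans ((measure_union_le _ _).trans (add_le_add
    ((measure_union_le _ _).trans (add_le_add ((measure_union_le _ _).trans
      (add_le_add h1 h2)) h3)) h4.le)) |>.trans ?_
  · intro ω hω
    by_contra hgood
    simp only [Set.mem_union, Set.mem_ofPred_eq, not_or, not_exists, not_and, not_lt, not_le]
      at hgood
    obtain ⟨⟨⟨g1, g2⟩, g3⟩, g4⟩ := hgood
    have hθ : ∀ t < T, OPLB.wnorm (I.gram (fun s => X s ω) t)
        (θs - I.thetaHat (fun s => X s ω) (OPLB.signal θs X ξr ω) t) ≤ I.beta (t + 1) d := by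
      intro t ht
      exact I.wnorm_sub_thetaHat_le hR hlam0 hδ0 hθS (fun s hs => g4 s (hs.trans ht)) (g1 t ht.le)
    have hμ : ∀ t < T, OPLB.projPerp I.x₀ μs ∈
        I.costSet (fun s => X s ω) (OPLB.signal μs X ξc ω) t := by
      intro t ht
      exact I.projPerp_mem_costSet hR hlam0 hδ0 hμS hc₀ hαc (fun s hs => g4 s (hs.trans ht))
        (g2 t ht.le)
    refine hω ⟨fun t ht => ⟨hpol t ht ω, ?_⟩, ?_⟩
    · exact (I.expValue_le_pessCost hlam0 hc₀ (hμ t ht)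
        (OPLB.integrable_id_of_mem_policies (hpol t ht ω) (hAL t ht ω))).trans (halg t ht ω).1.2
    have hr1 : I.r₀ ≤ 1 := hr₀ ▸ (hAr 0 hT ω _ (hx₀ 0 hT ω)).2
    have hα : 0 ≤ I.αr + 1 := by
      have : 0 ≤ 2 * (1 - I.r₀) / (I.τ - I.c₀) :=
        div_nonneg (by linarith) (sub_nonneg.2 hτ.le)
      linarith
    have hB := I.beta_nonneg hR hS T d
    have hwidth := I.sum_wnorm_le hlam0 (x := fun s => X s ω) hlam g4
    rw [Finset.sum_sub_distrib] at g3
    calc OPLB.regret θs T πstar π ω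
        ≤ ∑ t ∈ Finset.range T, (I.αr + 1) * I.beta T d
            * ∫ y, OPLB.wnorm (I.gram (fun s => X s ω) t)⁻¹ y ∂(π t ω) := by
          refine Finset.sum_le_sum fun t ht => ?_
          have ht' := Finset.mem_range.1 ht
          refine (I.expValue_sub_le hR hS hlam0 hδ0 hδ1 (hAL t ht' ω) (hAr t ht' ω) (hx₀ t ht' ω)
            hr₀ hc₀ hτ hαc hαr (hθ t ht') (hμ t ht') (hstar t ht' ω).1 (halg t ht' ω)).trans ?_
          have h5 := I.beta_le_beta hR hlam0 hδ0 hδ1 (t := t + 1) (by omega) ht' (le_refl d)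
          have h6 : 0 ≤ ∫ y, OPLB.wnorm (I.gram (fun s => X s ω) t)⁻¹ y ∂(π t ω) :=
            integral_nonneg fun y => OPLB.wnorm_nonneg _ _
          gcongr
      _ = (I.αr + 1) * I.beta T d * ∑ t ∈ Finset.range T,
            ∫ y, OPLB.wnorm (I.gram (fun s => X s ω) t)⁻¹ y ∂(π t ω) := by
          rw [Finset.mul_sum]
      _ ≤ (I.αr + 1) * I.beta T d * (2 * (I.L / Real.sqrt I.lam)
            * Real.sqrt (2 * T * Real.log (1 / I.δ))
            + Real.sqrt (2 * T * d * Real.log (1 + T * I.L ^ 2 / I.lam))) := by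
          gcongr
          linarith
      _ = _ := by ring
  -- Here d ≥ 3 enters: d/2 ≥ 3/2 and k/2 ≥ 1, so the failures add up to at most δ√δ + δ + δ³ ≤ (3/4
  -- + 1 + 1/4)δ.
  · have hd3 : I.δ ^ ((d : ℝ) / 2) ≤ I.δ * Real.sqrt I.δ := by
      have h5 : (3 : ℝ) ≤ d := by exact_mod_cast hd
      rw [Real.sqrt_eq_rpow, ← Real.rpow_one_add' hδ0.le (by norm_num)]
      exact Real.rpow_le_rpow_of_exponent_ge hδ0 hδ1.le (by linarith)
    have hk3 : I.δ ^ ((k : ℝ) / 2) ≤ I.δ := by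
      have h5 : (2 : ℝ) ≤ k := by exact_mod_cast hk2
      conv_rhs => rw [← Real.rpow_one I.δ]
      exact Real.rpow_le_rpow_of_exponent_ge hδ0 hδ1.le (by linarith)
    have hs : Real.sqrt I.δ ≤ 3 / 4 := by
      rw [Real.sqrt_le_left (by norm_num)]
      linarith
    rw [add_zero, ← ENNReal.ofReal_add (by positivity) (by positivity),
      ← ENNReal.ofReal_add (by positivity) (by positivity)]
    refine ENNReal.ofReal_le_ofReal ?_
    have h6 : I.δ * Real.sqrt I.δ ≤ I.δ * (3 / 4) := by gcongr
    nlinarith [mul_pos hδ0 hδ0]
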